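/- **Theorem 1.3.** Let $M=\mathbb S^2\times\mathbb S^1$, let $(r,\theta)\in[0,2]\times[0,2\pi]$ be the polar coordinates on the unit sphere $\mathbb S^2$ given by $(r,\theta)\mapsto(\sin\tfrac{\pi r}{2}\cos\theta,\ \sin\tfrac{\pi r}{2}\sin\theta,\ \cos\tfrac{\pi r}{2})$, and let $\xi\in[0,2\pi]$ be the coordinate on $\mathbb S^1$. Let $$g_i=\varphi_i^{-2}\,(dr^2+u_i(r)^2\,d\theta^2)+\varphi_i^2\,d\xi^2,\qquad i\in\mathbb N,$$ be a sequence of smooth Riemannian metrics on $M$, where $\varphi_i\in C^\infty(\mathbb S^2)$, $\varphi_i>0$, and $u_i\in C^\infty([0,2])$ satisfies $u_i>0$ on $(0,2)$, $u_i(0)=u_i(2)=0$, $u_i'(0)=1$, $u_i'(2)=-1$ (and, as smoothness of $dr^2+u_i^2d\theta^2$ at the poles requires, all derivatives of $u_i$ of even order vanish at $0$ and $2$). Suppose that there are constants $V_0$ and $A_0>0$ such that, for all $i$, $$\operatorname{Scalar}_{g_i}\ge 0,\qquad \operatorname{Vol}_{g_i}(M)\le V_0,\qquad \operatorname{MinA}(M,g_i)=\inf\{\operatorname{Area}_{g_i}(\Sigma):\Sigma\text{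 a closed embedded minimal surface in }(M,g_i)\}\ge A_0 .$$ Then, after passing to a subsequence, there are functions $u_\infty$ on $[0,2]$ and $\varphi_\infty$ on $\mathbb S^2$ minus the two poles, with $u_\infty>0$ on $(0,2)$ and $\varphi_\infty>0$, such that $u_i\to u_\infty$ uniformly on $[0,2]$, $\varphi_i\to\varphi_\infty$ uniformly on $\Omega_\varepsilon=\{\varepsilon\le r\le 2-\varepsilon\}\subset\mathbb S^2$ for every $0<\varepsilon<1$, and such that, with $$g_\infty=\varphi_\infty^{-2}\,(dr^2+u_\infty^2\,d\theta^2)+\varphi_\infty^2\,d\xi^2\quad\text{on }\{0<r<2\}\subset M,$$ the following hold. 1. For every $1\le p<\infty$, the tensors $g_i$ and $g_\infty$ belong to $L^p(M,g_0)$ and $g_i\to g_\infty$ in $L^p(M,g_0)$ as symmetric $2$-tensors, that is, $\int_M|g_i-g_\infty|_{g_0}^p\,d\mu_{g_0}\to0$, where $g_0=\tfrac{\pi^2}{4}dr^2+\sin^2(\tfrac{\pi r}{2})\,d\theta^2+d\xi^2$ is the standard product metric on $\mathbb S^2\times\mathbb S^1$. 2. For every $0<\varepsilon<1$, the coefficients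 of $g_i$ in the coordinates $(r,\theta,\xi)$ converge to those of $g_\infty$ uniformly on $M_\varepsilon=\Omega_\varepsilon\times\mathbb S^1$. -/

import Mathlib

open Filter Topology MeasureTheory Set
open scoped ENNReal ContDiff Manifold Matrix

noncomputable section

namespace WarpedS2S1

/-! ### The manifold `M = 𝕊² × 𝕊¹` and its coordinates `(r, θ, ξ)` -/

/-- The unit sphere in `ℝ³`, with its standard smooth structure from Mathlib. -/
abbrev S2 : Type := Metric.sphere (0 : EuclideanSpace ℝ (Fin 3)) 1

instance factFinrankThree : Fact (Module.finrank ℝ (EuclideanSpace ℝ (Fin 3)) = 2 + 1) :=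
  ⟨by simp⟩

/-- The closed three-manifold `𝕊² × 𝕊¹`, with its standard smooth structure from Mathlib. -/
abbrev M : Type := S2 × Circle

/-- The model with corners of `M`. -/
abbrev modelM := (𝓡 2).prod (𝓡 1)

/-- Polar coordinates on the sphere, with radial parameter `r ∈ [0, 2]` and angle `θ`.
The poles are `r = 0` and `r = 2`. -/
def polarPt (r θ : ℝ) : S2 :=
  ⟨!₂[Real.sin (Real.pi * r / 2) * Real.cos θ, Real.sin (Real.pi * r / 2) * Real.sin θ,
      Real.cos (Real.pi * r / 2)], by
    have h1 := Real.sin_sq_add_cos_sq (Real.pi * r / 2)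
    have h2 := Real.sin_sq_add_cos_sq θ
    rw [mem_sphere_zero_iff_norm, EuclideanSpace.norm_eq, Real.sqrt_eq_one]
    simp only [Fin.sum_univ_three, Real.norm_eq_abs, sq_abs]
    simp
    linear_combination h1 + (Real.sin (Real.pi * r / 2)) ^ 2 * h2⟩

/-- The space of coordinate vectors `x = (r, θ, ξ)`. -/
abbrev Coord : Type := Fin 3 → ℝ

/-- The coordinate map `(r, θ, ξ) ↦ (polarPt r θ, e^{iξ})`.  On `{0 < r < 2}` it is a local
diffeomorphism onto `M` minus the two polar circles `r = 0` and `r = 2`. -/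
def coordMap (x : Coord) : M := (polarPt (x 0) (x 1), Circle.exp (x 2))

/-- The coordinate region `0 < r < 2` (the angles `θ`, `ξ` are arbitrary reals). -/
def strip : Set Coord := {x | 0 < x 0 ∧ x 0 < 2}

/-- The fundamental domain `0 < r < 2`, `0 < θ < 2π`, `0 < ξ < 2π`.  Its image under `coordMap`
is `M` up to a null set. -/
def box : Set Coord :=
  {x | x 0 ∈ Ioo 0 2 ∧ x 1 ∈ Ioo 0 (2 * Real.pi) ∧ x 2 ∈ Ioo 0 (2 * Real.pi)}

/-! ### Riemannian geometry in coordinates -/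

/-- A symmetric `2`-tensor in coordinates: its matrix of components at each point. -/
abbrev CoordTensor : Type := Coord → Matrix (Fin 3) (Fin 3) ℝ

/-- The partial derivative `∂ₐ f`. -/
def pd (a : Fin 3) (f : Coord → ℝ) (x : Coord) : ℝ := fderiv ℝ f x (Pi.single a 1)

/-- The Christoffel symbols `Γᵏᵢⱼ = ½ gᵏˡ (∂ᵢ gⱼₗ + ∂ⱼ gᵢₗ - ∂ₗ gᵢⱼ)`. -/
def christoffel (G : CoordTensor) (k i j : Fin 3) (x : Coord) : ℝ :=
  (1 / 2) * ∑ l, (G x)⁻¹ k l *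
    (pd i (fun y => G y j l) x + pd j (fun y => G y i l) x - pd l (fun y => G y i j) x)

/-- The scalar curvature
`gⁱʲ (∂ₖ Γᵏᵢⱼ - ∂ᵢ Γᵏₖⱼ + Γˡᵢⱼ Γᵏₖₗ - Γˡₖⱼ Γᵏᵢₗ)`. -/
def scalarCurvature (G : CoordTensor) (x : Coord) : ℝ :=
  ∑ i, ∑ j, (G x)⁻¹ i j *
    ((∑ k, pd k (christoffel G k i j) x) - (∑ k, pd i (christoffel G k k j) x)
      + (∑ k, ∑ l, christoffel G l i j x * christoffel G k k l x)
      - (∑ k, ∑ l, christoffel G l k j x * christoffel G k i l x))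

/-- The Riemannian volume measure `√(det g) dr dθ dξ` on the fundamental domain. -/
def volMeasure (G : CoordTensor) : Measure Coord :=
  (volume.restrict box).withDensity fun x => ENNReal.ofReal (√ (G x).det)

/-- The volume of `M`; the polar circles are null sets. -/
def vol (G : CoordTensor) : ℝ≥0∞ := volMeasure G univ

/-- The norm `|∇f|_g = (gᵏˡ ∂ₖf ∂ₗf)^{1/2}` of the gradient. -/
def gradNorm (G : CoordTensor) (f : Coord → ℝ) (x : Coord) : ℝ :=
  √ (∑ k, ∑ l, (G x)⁻¹ k l * pd k f x * pd l f x)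

/-- The mean curvature of the level set of `f` through `x` with respect to the unit normal
`ν = ∇f / |∇f|_g`, that is `div_g ν = (det g)^{-1/2} ∂ᵢ ((det g)^{1/2} νⁱ)`. -/
def meanCurvature (G : CoordTensor) (f : Coord → ℝ) (x : Coord) : ℝ :=
  (√ (G x).det)⁻¹ *
    ∑ i, pd i (fun y => √ (G y).det * ((∑ j, (G y)⁻¹ i j * pd j f y) / gradNorm G f y)) x

/-! ### Closed minimal surfaces, area and `MinA` -/

/-- `f` is a smooth local defining function, on the open set `W`, of the surface `S` in `M`. -/
structure IsDefiningFunction (S W : Set M) (f : M → ℝ) : Prop where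
  isOpen : IsOpen W
  smooth : ContMDiffOn modelM 𝓘(ℝ, ℝ) ∞ f W
  submersion : ∀ q ∈ S ∩ W, mfderiv modelM 𝓘(ℝ, ℝ) f q ≠ 0
  eq_zeroSet : S ∩ W = {q ∈ W | f q = 0}

/-- `S` is a closed (compact without boundary, non-empty) smooth embedded surface in `M` whose
mean curvature vanishes.  For a metric that is smooth on `M` the mean curvature is continuous on
`S`, and the points of `S` off the two polar circles are dense in `S`, so that it is enough to
compute it at these points, where the coordinates `(r, θ, ξ)` are available. -/
structure IsClosedMinimalSurface (G : CoordTensor) (S : Set M) : Prop where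
  isClosed : IsClosed S
  nonempty : S.Nonempty
  minimal : ∀ p ∈ S, ∃ (W : Set M) (f : M → ℝ), p ∈ W ∧ IsDefiningFunction S W f ∧
    ∀ x ∈ strip, coordMap x ∈ S ∩ W → meanCurvature G (f ∘ coordMap) x = 0

/-- A countable parametrization of the part of `S` off the polar circles: smooth maps `Y n`, each
defined on an open set `U n` of the plane and given in the coordinates `(r, θ, ξ)`, and Borel sets
`B n ⊆ U n` whose images together make up that part of `S`. -/
structure IsParametrization (S : Set M) (U : ℕ → Set (Fin 2 → ℝ))
    (Y : ℕ → (Fin 2 → ℝ) → Coord) (B : ℕ → Set (Fin 2 → ℝ)) : Prop where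
  isOpen : ∀ n, IsOpen (U n)
  smooth : ∀ n, ContDiffOn ℝ ∞ (Y n) (U n)
  mapsTo : ∀ n, MapsTo (Y n) (U n) strip
  subset : ∀ n, B n ⊆ U n
  measurable : ∀ n, MeasurableSet (B n)
  iUnion_eq : ⋃ n, (coordMap ∘ Y n) '' B n = S ∩ coordMap '' strip

/-- The area density `√(det (g(∂_α Y, ∂_β Y)))` of a parametrized surface. -/
def areaDensity (G : CoordTensor) (Y : (Fin 2 → ℝ) → Coord) (s : Fin 2 → ℝ) : ℝ :=
  √ (Matrix.of fun α β : Fin 2 =>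
      fderiv ℝ Y s (Pi.single α 1) ⬝ᵥ (G (Y s) *ᵥ fderiv ℝ Y s (Pi.single β 1))).det

/-- The area of a smooth surface `S`: the sum of the integrals of the area density over the pieces
of a parametrization.  A piece that covers a point of `S` several times counts it several times,
so the area is the infimum; it is attained by any parametrization that is one-to-one.  The polar
circles meet `S` in a set of zero area. -/
def area (G : CoordTensor) (S : Set M) : ℝ≥0∞ :=
  ⨅ (U : ℕ → Set (Fin 2 → ℝ)) (Y : ℕ → (Fin 2 → ℝ) → Coord) (B : ℕ → Set (Fin 2 → ℝ))
    (_ : IsParametrization S U Y B),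
    ∑' n, ∫⁻ s in B n, ENNReal.ofReal (areaDensity G (Y n) s)

/-- `MinA`: the infimum of the areas of the closed minimal surfaces. -/
def minA (G : CoordTensor) : ℝ≥0∞ :=
  ⨅ (S : Set M) (_ : IsClosedMinimalSurface G S), area G S

/-! ### The warped product metrics -/

/-- The metric `φ⁻² (dr² + u² dθ²) + φ² dξ²` in the coordinates `(r, θ, ξ)`. -/
def warpedMetric (u : ℝ → ℝ) (φ : S2 → ℝ) : CoordTensor := fun x =>
  Matrix.diagonal ![(φ (polarPt (x 0) (x 1)) ^ 2)⁻¹,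
    (φ (polarPt (x 0) (x 1)) ^ 2)⁻¹ * u (x 0) ^ 2,
    φ (polarPt (x 0) (x 1)) ^ 2]

/-- The conditions under which `dr² + u² dθ²`, `r ∈ [0, 2]`, is a smooth rotationally symmetric
Riemannian metric on the sphere (the last two fields say that `u` is odd to infinite order at each
pole) and `φ` is a smooth positive function on the sphere; equivalently, under which
`warpedMetric u φ` is a smooth Riemannian metric on `M`. -/
structure IsWarpingPair (u : ℝ → ℝ) (φ : S2 → ℝ) : Prop where
  u_smooth : ContDiffOn ℝ ∞ u (Icc 0 2)
  u_zero : u 0 = 0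
  u_two : u 2 = 0
  u_pos : ∀ r ∈ Ioo (0 : ℝ) 2, 0 < u r
  deriv_zero : derivWithin u (Icc 0 2) 0 = 1
  deriv_two : derivWithin u (Icc 0 2) 2 = -1
  even_deriv_zero : ∀ k : ℕ, iteratedDerivWithin (2 * k) u (Icc 0 2) 0 = 0
  even_deriv_two : ∀ k : ℕ, iteratedDerivWithin (2 * k) u (Icc 0 2) 2 = 0
  φ_smooth : ContMDiff (𝓡 2) 𝓘(ℝ, ℝ) ∞ φ
  φ_pos : ∀ q, 0 < φ q

/-! ### Convergence of tensors -/

/-- The standard product metric on `𝕊² × 𝕊¹` (unit sphere, circle of length `2π`) in the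
coordinates `(r, θ, ξ)`: the pull-back `(π/2)² dr² + sin²(πr/2) dθ² + dξ²` of the Euclidean
metric of `ℝ³ × ℂ` under `coordMap`. -/
def stdMetric : CoordTensor := fun x =>
  Matrix.diagonal ![(Real.pi / 2) ^ 2, Real.sin (Real.pi * x 0 / 2) ^ 2, 1]

/-- The pointwise norm `|T|_{g₀} = (g₀ᵃᵇ g₀ᶜᵈ T_{ac} T_{bd})^{1/2}` of a symmetric `2`-tensor. -/
def tensorNorm (T : CoordTensor) (x : Coord) : ℝ :=
  √ ((stdMetric x)⁻¹ * T x * (stdMetric x)⁻¹ * T x).trace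

/-- `T ∈ Lᵖ(M, g₀)`, for a symmetric `2`-tensor `T`. -/
def MemTensorLp (T : CoordTensor) (p : ℝ≥0∞) : Prop :=
  (∀ a b, AEStronglyMeasurable (fun x => T x a b) (volMeasure stdMetric)) ∧
    MemLp (tensorNorm T) p (volMeasure stdMetric)

/-- `T i → T'` in `Lᵖ(M, g₀)`, for symmetric `2`-tensors. -/
def TendstoTensorLp (T : ℕ → CoordTensor) (T' : CoordTensor) (p : ℝ≥0∞) : Prop :=
  (∀ i, MemTensorLp (T i) p) ∧ MemTensorLp T' p ∧
    Tendsto (fun i => eLpNorm (tensorNorm (T i - T')) p (volMeasure stdMetric)) atTop (𝓝 0)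

/-- The region `Ω_ε = {ε ≤ r ≤ 2 - ε}` of the sphere. -/
def OmegaEps (ε : ℝ) : Set S2 := {q | ∃ r ∈ Icc ε (2 - ε), ∃ θ : ℝ, q = polarPt r θ}

/-- The interior region `M_ε = Ω_ε × 𝕊¹`, in the coordinates `(r, θ, ξ)`. -/
def MEps (ε : ℝ) : Set Coord := {x | x 0 ∈ Icc ε (2 - ε)}

end WarpedS2S1

end

/-! Write φ = e^f. For e^{-2f} (dr² + u² dθ²) + e^{2f} dξ² the second derivatives of f cancel in the
scalar curvature, and nonnegativity becomes u f_r² + f_θ² / u ≤ -u''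
(`IsWarpingPair.gradient_bound`). Everything is drawn from this inequality and from two minimal
surfaces.

The profile u. The inequality makes u concave, so |u'| ≤ 1 and u is 1-Lipschitz. At a critical point
c of u the torus r = c is minimal and its area is 4π² u(c) whatever φ is; the bound on `minA` and
concavity then give u ≥ κ r (2 - r) with κ > 0 (`IsWarpingPair.lower_bound`).

Oscillation of f. By the weighted inequality |f_r| ≤ (t/2) u f_r² + 1/(2 t u), the first term
integrates to at most t because -u'' has total mass at most 2, and the second is a multiple of
`logRatio`, that is log (r / (2 - r)). In the angular direction f_θ is small on a well chosen nearby
circle. Since t is free, the oscillation of f is at most K + η |log (r / (2 - r))| for every η > 0: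
φ and 1/φ grow more slowly than any power at the poles (`IsWarpingPair.oscillationBound`,
`OscillationBound.exists_abs_sub_le`).

The value of f at one point. The volume is the integral of u/φ, so the volume bound keeps φ from
being small; the sphere ξ = 0 is minimal with area the integral of u/φ², so the area bound keeps φ
from being large (`exists_abs_logPolar_one_le`).

These estimates give equicontinuity and pointwise bounds, of u on [0,2] and of f away from the
poles, and Arzelà–Ascoli extracts the limits. The slow growth at the poles provides, for each p, an
integrable majorant, so dominated convergence upgrades local uniform convergence to convergence in
L^p. -/

noncomputable section

namespace WarpedS2S1

/-! ### Calculus of partial derivatives -/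

section PartialDerivatives

variable {a : Fin 3} {f g : Coord → ℝ} {x : Coord}

lemma pd_add (hf : DifferentiableAt ℝ f x) (hg : DifferentiableAt ℝ g x) :
    pd a (fun y => f y + g y) x = pd a f x + pd a g x := by
  simp [pd, fderiv_fun_add hf hg]

lemma pd_neg : pd a (fun y => -f y) x = -pd a f x := by
  simp [pd, fderiv_fun_neg]

lemma pd_sub (hf : DifferentiableAt ℝ f x) (hg : DifferentiableAt ℝ g x) :
    pd a (fun y => f y - g y) x = pd a f x - pd a g x := by
  simp [pd, fderiv_fun_sub hf hg]

lemma pd_mul (hf : DifferentiableAt ℝ f x) (hg : DifferentiableAt ℝ g x) :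
    pd a (fun y => f y * g y) x = f x * pd a g x + g x * pd a f x := by
  simp [pd, fderiv_fun_mul hf hg]

lemma pd_const (c : ℝ) : pd a (fun _ => c) x = 0 := by
  simp [pd]

lemma pd_pow (hf : DifferentiableAt ℝ f x) (n : ℕ) :
    pd a (fun y => f y ^ n) x = n * f x ^ (n - 1) * pd a f x := by
  simp [pd, fderiv_fun_pow n hf]

lemma pd_inv (hf : DifferentiableAt ℝ f x) (h : f x ≠ 0) :
    pd a (fun y => (f y)⁻¹) x = -(pd a f x) / f x ^ 2 := by
  have : HasFDerivAt (fun y => (f y)⁻¹) _ x := (hasDerivAt_inv h).comp_hasFDerivAt x hf.hasFDerivAt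
  rw [pd, this.fderiv]
  simp [pd]
  field_simp

lemma pd_exp (hf : DifferentiableAt ℝ f x) :
    pd a (fun y => Real.exp (f y)) x = Real.exp (f x) * pd a f x := by
  simp [pd, fderiv_exp hf]

lemma pd_congr (h : f =ᶠ[𝓝 x] g) : pd a f x = pd a g x := by
  simp [pd, h.fderiv_eq]

lemma hasDerivAt_line (x : Coord) (a : Fin 3) :
    HasDerivAt (fun t : ℝ => x + t • (Pi.single a 1 : Coord)) (Pi.single a 1) 0 := by
  simpa using ((hasDerivAt_id (0 : ℝ)).smul_const (Pi.single a 1 : Coord)).const_add x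

/-- The partial derivative vanishes if the function is locally constant along the coordinate line. -/
lemma pd_eq_zero (h : ∀ᶠ t in 𝓝 (0 : ℝ), f (x + t • Pi.single a 1) = f x) : pd a f x = 0 := by
  by_cases hf : DifferentiableAt ℝ f x
  · have h1 : HasDerivAt (fun t : ℝ => f (x + t • Pi.single a 1)) (pd a f x) 0 := by
      have hf' : HasFDerivAt f (fderiv ℝ f x) (x + (0 : ℝ) • (Pi.single a 1 : Coord)) := by
        simpa using hf.hasFDerivAt
      exact hf'.comp_hasDerivAt 0 (hasDerivAt_line x a)
    have h2 : HasDerivAt (fun t : ℝ => f (x + t • Pi.single a 1)) 0 0 :=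
      (hasDerivAt_const (0 : ℝ) (f x)).congr_of_eventuallyEq h
    exact h1.unique h2
  · simp [pd, fderiv_zero_of_not_differentiableAt hf]

lemma hasFDerivAt_coord (x : Coord) (b : Fin 3) :
    HasFDerivAt (fun y : Coord => y b) (ContinuousLinearMap.proj b : Coord →L[ℝ] ℝ) x :=
  (ContinuousLinearMap.proj b : Coord →L[ℝ] ℝ).hasFDerivAt

lemma pd_comp_coord {w : ℝ → ℝ} {b : Fin 3} (hw : DifferentiableAt ℝ w (x b)) :
    pd a (fun y => w (y b)) x = if b = a then deriv w (x b) else 0 := by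
  have : HasFDerivAt (fun y : Coord => w (y b)) _ x :=
    hw.hasDerivAt.comp_hasFDerivAt x (hasFDerivAt_coord x b)
  rw [pd, this.fderiv]
  simp [Pi.single_apply]

lemma contDiffAt_pd (hf : ContDiffAt ℝ ∞ f x) : ContDiffAt ℝ ∞ (pd a f) x := by
  unfold pd
  exact (hf.fderiv_right (m := ∞) (by simp)).clm_apply contDiffAt_const

end PartialDerivatives

/-! ### The scalar curvature of `e^{-2f} (dr² + v² dθ²) + e^{2f} dξ²` -/

section ScalarCurvature

variable {f v : Coord → ℝ} {O : Set Coord}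

/-- The metric `e^{-2f} (dr² + v² dθ²) + e^{2f} dξ²`. -/
def expMetric (f v : Coord → ℝ) : CoordTensor := fun x =>
  Matrix.diagonal ![Real.exp (-(2 * f x)), Real.exp (-(2 * f x)) * v x ^ 2, Real.exp (2 * f x)]

lemma inv_diagonal_three {a b c : ℝ} (ha : a ≠ 0) (hb : b ≠ 0) (hc : c ≠ 0) :
    (Matrix.diagonal ![a, b, c])⁻¹ = Matrix.diagonal ![a⁻¹, b⁻¹, c⁻¹] := by
  apply Matrix.inv_eq_right_inv
  rw [Matrix.diagonal_mul_diagonal, ← Matrix.diagonal_one]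
  congr 1
  ext i
  fin_cases i <;> simp [ha, hb, hc]

/-- The Christoffel symbols `Γᵏᵢⱼ` of `expMetric f v`, as a table indexed by `k`, `i`, `j`. -/
def expChristoffel (f v : Coord → ℝ) (x : Coord) : Fin 3 → Fin 3 → Fin 3 → ℝ :=
  let p := pd 0 f x
  let q := pd 1 f x
  let w := pd 0 v x
  let E := Real.exp (4 * f x)
  ![![![-p, -q, 0], ![-q, p * v x ^ 2 - v x * w, 0], ![0, 0, -(p * E)]],
    ![![q * (v x ^ 2)⁻¹, -p + w * (v x)⁻¹, 0], ![-p + w * (v x)⁻¹, -q, 0],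
      ![0, 0, -(q * (v x ^ 2)⁻¹ * E)]],
    ![![0, 0, p], ![0, 0, q], ![p, q, 0]]]

lemma christoffel_expMetric {x : Coord} (hf : DifferentiableAt ℝ f x) (hv : DifferentiableAt ℝ v x)
    (hv0 : v x ≠ 0) (hf2 : pd 2 f x = 0) (hv1 : pd 1 v x = 0) (hv2 : pd 2 v x = 0)
    (k i j : Fin 3) : christoffel (expMetric f v) k i j x = expChristoffel f v x k i j := by
  have d0 : ∀ a, pd a (fun y => Real.exp (-(2 * f y))) x
      = -(2 * pd a f x) * Real.exp (-(2 * f x)) := fun a => by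
    rw [pd_exp (by fun_prop), pd_neg, pd_mul (by fun_prop) hf, pd_const]; ring
  have d2 : ∀ a, pd a (fun y => Real.exp (2 * f y)) x = 2 * pd a f x * Real.exp (2 * f x) :=
    fun a => by
    rw [pd_exp (by fun_prop), pd_mul (by fun_prop) hf, pd_const]; ring
  have d1 : ∀ a, pd a (fun y => Real.exp (-(2 * f y)) * v y ^ 2) x
      = Real.exp (-(2 * f x)) * (2 * v x * pd a v x - 2 * pd a f x * v x ^ 2) := fun a => by
    rw [pd_mul (by fun_prop) (by fun_prop), d0, pd_pow hv]; norm_num; ring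
  -- All exponentials are rewritten through `Real.exp (2 * f x)`, which `field_simp` and `ring` then
  -- treat as one nonzero atom.
  have e4 : Real.exp (4 * f x) = Real.exp (2 * f x) * Real.exp (2 * f x) := by
    rw [← Real.exp_add]; ring_nf
  have em : Real.exp (-(2 * f x)) = (Real.exp (2 * f x))⁻¹ := Real.exp_neg _
  have hE : Real.exp (2 * f x) ≠ 0 := (Real.exp_pos _).ne'
  have hinv : (expMetric f v x)⁻¹ = Matrix.diagonal ![(Real.exp (-(2 * f x)))⁻¹,
      (Real.exp (-(2 * f x)) * v x ^ 2)⁻¹, (Real.exp (2 * f x))⁻¹] :=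
    inv_diagonal_three (by positivity) (by positivity) (by positivity)
  unfold christoffel
  rw [hinv]
  fin_cases k <;> fin_cases i <;> fin_cases j <;>
    simp [Matrix.diagonal_apply, expMetric, expChristoffel, d0, d1, d2, pd_const,
      hf2, hv1, hv2, e4, em] <;> field_simp <;> ring

/-- Twice the Gauss curvature of the base contributes +2Δf through the conformal factor e^{-2f}, and
the fibre of length e^f contributes -2(Δf + |∇f|²). The Laplacians cancel because the two factors
are reciprocal; what survives is the curvature -v''/v of dr² + v² dθ² minus |∇f|². -/
theorem scalarCurvature_expMetric (hO : IsOpen O) (hf : ContDiffOn ℝ ∞ f O)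
    (hv : ContDiffOn ℝ ∞ v O) (hv0 : ∀ x ∈ O, v x ≠ 0) (hf2 : ∀ x ∈ O, pd 2 f x = 0)
    (hv1 : ∀ x ∈ O, pd 1 v x = 0) (hv2 : ∀ x ∈ O, pd 2 v x = 0) {x : Coord} (hx : x ∈ O) :
    scalarCurvature (expMetric f v) x = 2 * Real.exp (2 * f x) *
      (-(pd 0 (pd 0 v) x) / v x - pd 0 f x ^ 2 - pd 1 f x ^ 2 / v x ^ 2) := by
  have hfx := hf.contDiffAt (hO.mem_nhds hx)
  have hvx := hv.contDiffAt (hO.mem_nhds hx)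
  have n0 : (∞ : WithTop ℕ∞) ≠ 0 := by simp
  have df : DifferentiableAt ℝ f x := hfx.differentiableAt n0
  have dv : DifferentiableAt ℝ v x := hvx.differentiableAt n0
  have dp : ∀ a, DifferentiableAt ℝ (pd a f) x := fun a => (contDiffAt_pd hfx).differentiableAt n0
  have dw : DifferentiableAt ℝ (pd 0 v) x := (contDiffAt_pd hvx).differentiableAt n0
  have hvx0 := hv0 x hx
  -- The table is needed on a whole neighbourhood, since the Christoffel symbols are differentiated
  -- once more.
  have key : ∀ k i j, ∀ᶠ y in 𝓝 x,
      christoffel (expMetric f v) k i j y = expChristoffel f v y k i j := fun k i j => by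
    filter_upwards [hO.mem_nhds hx] with y hy
    have hfy := (hf.contDiffAt (hO.mem_nhds hy)).differentiableAt n0
    have hvy := (hv.contDiffAt (hO.mem_nhds hy)).differentiableAt n0
    exact christoffel_expMetric hfy hvy (hv0 y hy) (hf2 y hy) (hv1 y hy) (hv2 y hy) k i j
  have key' : ∀ k i j a, pd a (christoffel (expMetric f v) k i j) x
      = pd a (fun y => expChristoffel f v y k i j) x := fun k i j a => pd_congr (key k i j)
  have keyx : ∀ k i j, christoffel (expMetric f v) k i j x = expChristoffel f v x k i j :=
    fun k i j => (key k i j).self_of_nhds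
  have hinv : (expMetric f v x)⁻¹ = Matrix.diagonal ![(Real.exp (-(2 * f x)))⁻¹,
      (Real.exp (-(2 * f x)) * v x ^ 2)⁻¹, (Real.exp (2 * f x))⁻¹] :=
    inv_diagonal_three (by positivity) (by positivity) (by positivity)
  have e4 : Real.exp (4 * f x) = Real.exp (2 * f x) * Real.exp (2 * f x) := by
    rw [← Real.exp_add]; ring_nf
  have em : Real.exp (-(2 * f x)) = (Real.exp (2 * f x))⁻¹ := Real.exp_neg _
  have dE : DifferentiableAt ℝ (fun y => Real.exp (4 * f y)) x := by fun_prop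
  have pE : ∀ a, pd a (fun y => Real.exp (4 * f y)) x = 4 * pd a f x * Real.exp (4 * f x) :=
    fun a => by rw [pd_exp (by fun_prop), pd_mul (by fun_prop) df, pd_const]; ring
  have dvi : DifferentiableAt ℝ (fun y => (v y)⁻¹) x := dv.inv hvx0
  have dvi2 : DifferentiableAt ℝ (fun y => (v y ^ 2)⁻¹) x := (dv.fun_pow 2).inv (pow_ne_zero 2 hvx0)
  have pv2 : ∀ a, pd a (fun y => v y ^ 2) x = 2 * v x * pd a v x := fun a => by
    rw [pd_pow dv]; norm_num
  have pvi : ∀ a, pd a (fun y => (v y)⁻¹) x = -(pd a v x) / v x ^ 2 := fun a => pd_inv dv hvx0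
  have pvi2 : ∀ a, pd a (fun y => (v y ^ 2)⁻¹) x = -(2 * v x * pd a v x) / (v x ^ 2) ^ 2 :=
    fun a => by rw [pd_inv (dv.fun_pow 2) (pow_ne_zero 2 hvx0), pv2]
  have t1 : ∀ a, pd a (fun y => pd 0 f y * v y ^ 2 - v y * pd 0 v y) x
      = pd a (pd 0 f) x * v x ^ 2 + pd 0 f x * (2 * v x * pd a v x)
        - (pd a v x * pd 0 v x + v x * pd a (pd 0 v) x) := fun a => by
    rw [pd_sub (by fun_prop) (by fun_prop), pd_mul (dp 0) (by fun_prop), pd_mul dv dw, pv2]; ring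
  have t2 : ∀ a, pd a (fun y => pd 0 f y * Real.exp (4 * f y)) x
      = (pd a (pd 0 f) x + 4 * pd 0 f x * pd a f x) * Real.exp (4 * f x) := fun a => by
    rw [pd_mul (dp 0) dE, pE]; ring
  have t3 : ∀ a, pd a (fun y => pd 1 f y * (v y ^ 2)⁻¹) x
      = pd a (pd 1 f) x * (v x ^ 2)⁻¹ - pd 1 f x * (2 * v x * pd a v x) / (v x ^ 2) ^ 2 :=
    fun a => by rw [pd_mul (dp 1) dvi2, pvi2]; ring
  have t4 : ∀ a, pd a (fun y => -pd 0 f y + pd 0 v y * (v y)⁻¹) x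
      = -pd a (pd 0 f) x + pd a (pd 0 v) x * (v x)⁻¹ - pd 0 v x * pd a v x / v x ^ 2 :=
    fun a => by rw [pd_add (by fun_prop) (by fun_prop), pd_neg, pd_mul dw dvi, pvi]; ring
  have t5 : ∀ a, pd a (fun y => pd 1 f y * (v y ^ 2)⁻¹ * Real.exp (4 * f y)) x
      = (pd a (pd 1 f) x * (v x ^ 2)⁻¹ - pd 1 f x * (2 * v x * pd a v x) / (v x ^ 2) ^ 2
        + 4 * pd 1 f x * (v x ^ 2)⁻¹ * pd a f x) * Real.exp (4 * f x) :=
    fun a => by rw [pd_mul (by fun_prop) dE, t3, pE]; ring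
  unfold scalarCurvature
  simp only [keyx, key', hinv]
  simp only [expChristoffel, Fin.sum_univ_three, Matrix.diagonal_apply]
  simp [pd_const, pd_neg, t1, t2, t3, t4, t5, hv1 x hx, e4, em]
  have hE : Real.exp (2 * f x) ≠ 0 := (Real.exp_pos _).ne'
  field_simp
  ring

end ScalarCurvature

/-! ### Polar coordinates -/

lemma contMDiff_polarPt {E : Type*} [NormedAddCommGroup E] [NormedSpace ℝ E] {r θ : E → ℝ}
    (hr : ContDiff ℝ ∞ r) (hθ : ContDiff ℝ ∞ θ) :
    ContMDiff 𝓘(ℝ, E) (𝓡 2) ∞ (fun x => polarPt (r x) (θ x)) := by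
  unfold polarPt
  apply ContMDiff.codRestrict_sphere
  rw [contMDiff_iff_contDiff, contDiff_euclidean]
  intro i
  fin_cases i <;> simp <;> fun_prop

lemma contMDiff_coordMap {E : Type*} [NormedAddCommGroup E] [NormedSpace ℝ E] {y : E → Coord}
    (hy : ContDiff ℝ ∞ y) : ContMDiff 𝓘(ℝ, E) modelM ∞ (fun x => coordMap (y x)) := by
  have h : ∀ a, ContDiff ℝ ∞ (fun x => y x a) := fun a => by fun_prop
  exact (contMDiff_polarPt (h 0) (h 1)).prodMk
    ((contMDiff_circleExp.of_le le_top).comp (h 2).contMDiff)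

lemma polarPt_add_two_pi_mul (r θ : ℝ) (n : ℤ) : polarPt r (θ + n * (2 * Real.pi)) = polarPt r θ := by
  simp [polarPt, Real.sin_add_int_mul_two_pi, Real.cos_add_int_mul_two_pi]

lemma exists_angle (θ : ℝ) : ∃ θ' ∈ Icc 0 (2 * Real.pi), ∃ n : ℤ, θ' = θ + n * (2 * Real.pi) := by
  refine ⟨toIcoMod Real.two_pi_pos 0 θ, ?_, -toIcoDiv Real.two_pi_pos 0 θ, ?_⟩
  · simpa using Ico_subset_Icc_self (toIcoMod_mem_Ico' Real.two_pi_pos θ)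
  · rw [toIcoMod]; push_cast; rw [zsmul_eq_mul]; ring

/-- The function `log φ` in the coordinates `(r, θ)`. -/
def logPolar (φ : S2 → ℝ) (r θ : ℝ) : ℝ := Real.log (φ (polarPt r θ))

variable {u : ℝ → ℝ} {φ : S2 → ℝ}

lemma exp_logPolar (hw : ∀ q, 0 < φ q) (r θ : ℝ) : Real.exp (logPolar φ r θ) = φ (polarPt r θ) :=
  Real.exp_log (hw _)

lemma logPolar_periodic (r θ : ℝ) (n : ℤ) :
    logPolar φ r (θ + n * (2 * Real.pi)) = logPolar φ r θ := by
  simp [logPolar, polarPt_add_two_pi_mul]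

lemma IsWarpingPair.contDiff_polar (hw : IsWarpingPair u φ) {E : Type*} [NormedAddCommGroup E]
    [NormedSpace ℝ E] {r θ : E → ℝ} (hr : ContDiff ℝ ∞ r) (hθ : ContDiff ℝ ∞ θ) :
    ContDiff ℝ ∞ (fun x => φ (polarPt (r x) (θ x))) :=
  (hw.φ_smooth.comp (contMDiff_polarPt hr hθ)).contDiff

lemma IsWarpingPair.contDiff_logPolar (hw : IsWarpingPair u φ) {E : Type*} [NormedAddCommGroup E]
    [NormedSpace ℝ E] {r θ : E → ℝ} (hr : ContDiff ℝ ∞ r) (hθ : ContDiff ℝ ∞ θ) :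
    ContDiff ℝ ∞ (fun x => logPolar φ (r x) (θ x)) :=
  (hw.contDiff_polar hr hθ).log fun _ => (hw.φ_pos _).ne'

lemma isOpen_strip : IsOpen strip := by
  unfold strip
  exact (isOpen_lt continuous_const (continuous_apply 0)).inter
    (isOpen_lt (continuous_apply 0) continuous_const)

lemma warpedMetric_eq_expMetric (hφ : ∀ q, 0 < φ q) :
    warpedMetric u φ = expMetric (fun x => logPolar φ (x 0) (x 1)) (fun x => u (x 0)) := by
  funext x
  unfold warpedMetric expMetric
  have h : Real.exp (2 * logPolar φ (x 0) (x 1)) = φ (polarPt (x 0) (x 1)) ^ 2 := by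
    rw [← exp_logPolar hφ, ← Real.exp_nat_mul]; norm_num
  rw [Real.exp_neg, h]

lemma IsWarpingPair.contDiffAt (hw : IsWarpingPair u φ) {r : ℝ} (hr : r ∈ Ioo (0 : ℝ) 2) :
    ContDiffAt ℝ ∞ u r :=
  hw.u_smooth.contDiffAt (Icc_mem_nhds hr.1 hr.2)

lemma IsWarpingPair.differentiableAt (hw : IsWarpingPair u φ) {r : ℝ} (hr : r ∈ Ioo (0 : ℝ) 2) :
    DifferentiableAt ℝ u r :=
  (hw.contDiffAt hr).differentiableAt (by simp)

lemma IsWarpingPair.contDiffAt_deriv (hw : IsWarpingPair u φ) {r : ℝ} (hr : r ∈ Ioo (0 : ℝ) 2) :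
    ContDiffAt ℝ ∞ (deriv u) r :=
  ((hw.contDiffAt hr).fderiv_right (m := ∞) (by simp)).clm_apply contDiffAt_const

lemma IsWarpingPair.differentiableAt_deriv (hw : IsWarpingPair u φ) {r : ℝ}
    (hr : r ∈ Ioo (0 : ℝ) 2) : DifferentiableAt ℝ (deriv u) r :=
  (hw.contDiffAt_deriv hr).differentiableAt (by simp)

/-- Nonnegative scalar curvature of the warped metric is a gradient bound for `log φ`. -/
theorem IsWarpingPair.gradient_bound (hw : IsWarpingPair u φ)
    (hs : ∀ x ∈ strip, 0 ≤ scalarCurvature (warpedMetric u φ) x) {r : ℝ} (hr : r ∈ Ioo (0 : ℝ) 2)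
    (θ : ℝ) :
    u r * deriv (fun s => logPolar φ s θ) r ^ 2 + deriv (fun t => logPolar φ r t) θ ^ 2 / u r
      ≤ -deriv (deriv u) r := by
  set f : Coord → ℝ := fun x => logPolar φ (x 0) (x 1) with hf
  set v : Coord → ℝ := fun x => u (x 0) with hv
  have hfs : ContDiff ℝ ∞ f := hw.contDiff_logPolar (by fun_prop) (by fun_prop)
  have hdf : Differentiable ℝ f := hfs.differentiable (by simp)
  have hvs : ContDiffOn ℝ ∞ v strip := fun x hx =>
    ((hw.contDiffAt hx).comp x (f := fun y : Coord => y 0) (by fun_prop)).contDiffWithinAt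
  have hpv : ∀ x ∈ strip, ∀ a, pd a v x = if 0 = a then deriv u (x 0) else 0 := fun x hx a =>
    pd_comp_coord (hw.differentiableAt hx)
  have hx : (![r, θ, 0] : Coord) ∈ strip := hr
  have h := hs _ hx
  rw [warpedMetric_eq_expMetric hw.φ_pos, scalarCurvature_expMetric isOpen_strip
    hfs.contDiffOn hvs (fun x hx => (hw.u_pos _ hx).ne')
    (fun x _ => pd_eq_zero (by simp [f]))
    (fun x hx => by simp [hpv x hx]) (fun x hx => by simp [hpv x hx]) hx] at h
  have h2 : pd 0 (pd 0 v) ![r, θ, 0] = deriv (deriv u) r := by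
    rw [pd_congr (g := fun y => deriv u (y 0))]
    · rw [pd_comp_coord (hw.differentiableAt_deriv hr)]; simp
    · filter_upwards [isOpen_strip.mem_nhds hx] with y hy
      simp [hpv y hy]
  have hline : ∀ a : Fin 3, HasDerivAt (fun t : ℝ => f (![r, θ, 0] + t • Pi.single a 1))
      (pd a f ![r, θ, 0]) 0 := fun a => by
    have hf' : HasFDerivAt f (fderiv ℝ f ![r, θ, 0])
        (![r, θ, 0] + (0 : ℝ) • (Pi.single a 1 : Coord)) := by
      simpa using (hdf _).hasFDerivAt
    exact hf'.comp_hasDerivAt 0 (hasDerivAt_line _ a)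
  have h0 : deriv (fun s => logPolar φ s θ) r = pd 0 f ![r, θ, 0] := by
    have e : (fun t : ℝ => f (![r, θ, 0] + t • Pi.single 0 1)) = fun t => logPolar φ (r + t) θ := by
      funext t
      simp only [f, Pi.add_apply, Pi.smul_apply]
      simp
    rw [← (hline 0).deriv, e]
    simpa using (deriv_comp_const_add (f := fun s => logPolar φ s θ) r 0).symm
  have h1 : deriv (fun s => logPolar φ r s) θ = pd 1 f ![r, θ, 0] := by
    have e : (fun t : ℝ => f (![r, θ, 0] + t • Pi.single 1 1)) = fun t => logPolar φ r (θ + t) := by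
      funext t
      simp only [f, Pi.add_apply, Pi.smul_apply]
      simp
    rw [← (hline 1).deriv, e]
    simpa using (deriv_comp_const_add (f := fun s => logPolar φ r s) θ 0).symm
  have hu := hw.u_pos r hr
  -- The positive factor 2e^{2f} is dropped; multiplying by u then clears one denominator.
  have h3 := nonneg_of_mul_nonneg_right h (by positivity)
  rw [h2, ← h0, ← h1] at h3
  simp only [hv, Matrix.cons_val_zero] at h3
  have h4 := mul_nonneg hu.le h3
  have h5 : u r * (-deriv (deriv u) r / u r - deriv (fun s => logPolar φ s θ) r ^ 2
      - deriv (fun s => logPolar φ r s) θ ^ 2 / u r ^ 2) = -deriv (deriv u) r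
      - (u r * deriv (fun s => logPolar φ s θ) r ^ 2
        + deriv (fun t => logPolar φ r t) θ ^ 2 / u r) := by
    field_simp
    ring
  linarith

/-! ### Minimal tori and spheres -/

section MinimalSurfaces

variable {u : ℝ → ℝ} {φ : S2 → ℝ}

lemma sqrt_det_warpedMetric {x : Coord} (hφ : ∀ q, 0 < φ q) (hu : 0 ≤ u (x 0)) :
    √ (warpedMetric u φ x).det = u (x 0) / φ (polarPt (x 0) (x 1)) := by
  have h := hφ (polarPt (x 0) (x 1))
  rw [warpedMetric, Matrix.det_diagonal, Real.sqrt_eq_iff_mul_self_eq (by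
    simp only [Fin.prod_univ_three]
    simp
    positivity) (by positivity)]
  simp only [Fin.prod_univ_three]
  simp
  field_simp

lemma inv_warpedMetric {x : Coord} (hφ : ∀ q, 0 < φ q) (hu : u (x 0) ≠ 0) :
    (warpedMetric u φ x)⁻¹ = Matrix.diagonal ![φ (polarPt (x 0) (x 1)) ^ 2,
      φ (polarPt (x 0) (x 1)) ^ 2 * (u (x 0) ^ 2)⁻¹, (φ (polarPt (x 0) (x 1)) ^ 2)⁻¹] := by
  have h := (hφ (polarPt (x 0) (x 1))).ne'
  rw [warpedMetric, inv_diagonal_three (by positivity) (by positivity) (by positivity)]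
  simp [mul_comm]

/-- The unit normal of the level sets of a function of the coordinate `r`. -/
lemma normal_of_radial {x : Coord} (hφ : ∀ q, 0 < φ q) (hu : u (x 0) ≠ 0) {F : Coord → ℝ} {D : ℝ}
    (hD : D < 0) (hF : ∀ a, pd a F x = if 0 = a then D else 0) (i : Fin 3) :
    (∑ j, (warpedMetric u φ x)⁻¹ i j * pd j F x) / gradNorm (warpedMetric u φ) F x
      = if i = 0 then -φ (polarPt (x 0) (x 1)) else 0 := by
  have h := hφ (polarPt (x 0) (x 1))
  have h1 : gradNorm (warpedMetric u φ) F x = φ (polarPt (x 0) (x 1)) * (-D) := by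
    rw [gradNorm, inv_warpedMetric hφ hu, Real.sqrt_eq_iff_mul_self_eq_of_pos (by nlinarith)]
    simp [Matrix.diagonal_apply, hF]
    ring
  have hD' := hD.ne
  rw [h1, inv_warpedMetric hφ hu]
  fin_cases i <;> simp [Matrix.diagonal_apply, hF]
  field_simp

/-- The unit normal of the level sets of a function of the coordinate `ξ`. -/
lemma normal_of_fiber {x : Coord} (hφ : ∀ q, 0 < φ q) (hu : u (x 0) ≠ 0) {F : Coord → ℝ} {D : ℝ}
    (hD : 0 < D) (hF : ∀ a, pd a F x = if 2 = a then D else 0) (i : Fin 3) :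
    (∑ j, (warpedMetric u φ x)⁻¹ i j * pd j F x) / gradNorm (warpedMetric u φ) F x
      = if i = 2 then (φ (polarPt (x 0) (x 1)))⁻¹ else 0 := by
  have h := hφ (polarPt (x 0) (x 1))
  have h1 : gradNorm (warpedMetric u φ) F x = (φ (polarPt (x 0) (x 1)))⁻¹ * D := by
    rw [gradNorm, inv_warpedMetric hφ hu, Real.sqrt_eq_iff_mul_self_eq_of_pos (by positivity)]
    simp [Matrix.diagonal_apply, hF]
    ring
  rw [h1, inv_warpedMetric hφ hu]
  fin_cases i <;> simp [Matrix.diagonal_apply, hF]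
  field_simp

/-- The differential of a function is nonzero where its derivative along a curve is nonzero. -/
lemma mfderiv_ne_zero_of_curve {f : M → ℝ} {y : ℝ → Coord} {t D : ℝ} (hy : ContDiff ℝ ∞ y)
    (hf : MDifferentiableAt modelM 𝓘(ℝ, ℝ) f (coordMap (y t)))
    (hD : HasDerivAt (fun s => f (coordMap (y s))) D t) (hD0 : D ≠ 0) :
    mfderiv modelM 𝓘(ℝ, ℝ) f (coordMap (y t)) ≠ 0 := by
  intro h0
  have hc : MDifferentiableAt 𝓘(ℝ, ℝ) modelM (fun s => coordMap (y s)) t :=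
    (contMDiff_coordMap hy).mdifferentiableAt (by simp)
  have h1 := mfderiv_comp t (g := f) (f := fun s => coordMap (y s)) hf hc
  rw [h0] at h1
  have h2 := hD.hasFDerivAt.hasMFDerivAt.mfderiv
  have h3 : mfderiv 𝓘(ℝ, ℝ) 𝓘(ℝ, ℝ) (fun s => f (coordMap (y s))) t = 0 := by
    change mfderiv 𝓘(ℝ, ℝ) 𝓘(ℝ, ℝ) (f ∘ fun s => coordMap (y s)) t = 0
    rw [h1]
    rfl
  rw [h2] at h3
  apply hD0
  have h4 : (ContinuousLinearMap.toSpanSingleton ℝ D : ℝ →L[ℝ] ℝ) = 0 := h3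
  simpa using congrArg (fun L : ℝ →L[ℝ] ℝ => L 1) h4

/-- The height function on the sphere. -/
def height (p : M) : ℝ := (p.1 : EuclideanSpace ℝ (Fin 3)) 2

lemma contMDiff_height : ContMDiff modelM 𝓘(ℝ, ℝ) ∞ height := by
  have h1 : ContMDiff (𝓡 2) 𝓘(ℝ, EuclideanSpace ℝ (Fin 3)) ∞
      ((↑) : S2 → EuclideanSpace ℝ (Fin 3)) := contMDiff_coe_sphere
  have h2 : ContDiff ℝ ∞ (fun v : EuclideanSpace ℝ (Fin 3) => v 2) := by fun_prop
  exact (h2.contMDiff.comp h1).comp contMDiff_fst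

@[simp] lemma height_coordMap (x : Coord) : height (coordMap x) = Real.cos (Real.pi * x 0 / 2) := by
  simp [height, coordMap, polarPt]

/-- The angles are complex arguments: of the horizontal part of the point of the sphere, whose
modulus is sin(πc/2), and of the point of the circle. The poles need no separate treatment. -/
lemma exists_radius {c : ℝ} (hc : c ∈ Icc (0 : ℝ) 2) {p : M}
    (hp : height p = Real.cos (Real.pi * c / 2)) :
    ∃ θ ξ : ℝ, coordMap ![c, θ, ξ] = p := by
  obtain ⟨⟨q, hq⟩, z⟩ := p
  have hs : 0 ≤ Real.sin (Real.pi * c / 2) :=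
    Real.sin_nonneg_of_nonneg_of_le_pi (by have := Real.pi_pos; have := hc.1; positivity)
      (by nlinarith [Real.pi_pos, hc.2])
  have hp' : q 2 = Real.cos (Real.pi * c / 2) := hp
  have hw : ‖(⟨q 0, q 1⟩ : ℂ)‖ = Real.sin (Real.pi * c / 2) := by
    rw [mem_sphere_zero_iff_norm, EuclideanSpace.norm_eq, Real.sqrt_eq_one] at hq
    simp only [Fin.sum_univ_three, Real.norm_eq_abs, sq_abs] at hq
    rw [Complex.norm_def, Real.sqrt_eq_iff_mul_self_eq (Complex.normSq_nonneg _) hs,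
      Complex.normSq_mk]
    have := Real.sin_sq_add_cos_sq (Real.pi * c / 2)
    rw [← hp'] at this
    linarith
  refine ⟨Complex.arg ⟨q 0, q 1⟩, Complex.arg z, ?_⟩
  have h0 := Complex.norm_mul_cos_arg ⟨q 0, q 1⟩
  have h1 := Complex.norm_mul_sin_arg ⟨q 0, q 1⟩
  rw [hw] at h0 h1
  unfold coordMap polarPt
  refine Prod.ext (Subtype.ext ?_) (by simp [Circle.exp_arg])
  ext i
  fin_cases i
  · simpa using h0
  · simpa using h1
  · simpa using hp'.symm

lemma exists_coord (p : M) : ∃ x : Coord, coordMap x = p := by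
  have h := mem_sphere_zero_iff_norm.1 p.1.2
  have h2 : |height p| ≤ 1 := h ▸ PiLp.norm_apply_le (p.1 : EuclideanSpace ℝ (Fin 3)) 2
  have hpi := Real.pi_pos
  obtain ⟨θ, ξ, e⟩ := exists_radius (c := 2 / Real.pi * Real.arccos (height p)) (p := p)
    ⟨by have := Real.arccos_nonneg (height p); positivity, by
      have := Real.arccos_le_pi (height p)
      rw [div_mul_eq_mul_div, div_le_iff₀ hpi]
      linarith⟩ (by
      rw [show Real.pi * (2 / Real.pi * Real.arccos (height p)) / 2 = Real.arccos (height p) by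
        field_simp, Real.cos_arccos (abs_le.1 h2).1 (abs_le.1 h2).2])
  exact ⟨_, e⟩

/-- The torus `r = c`. -/
def radialTorus (c : ℝ) : Set M := {p | height p = Real.cos (Real.pi * c / 2)}

lemma hasDerivAt_cos_radius (r : ℝ) : HasDerivAt (fun s => Real.cos (Real.pi * s / 2))
    (-(Real.sin (Real.pi * r / 2) * (Real.pi / 2))) r := by
  have h1 : HasDerivAt (fun s => Real.pi * s / 2) (Real.pi / 2) r := by
    simpa using ((hasDerivAt_id r).const_mul Real.pi).div_const 2
  simpa using h1.cos

lemma sin_radius_pos {r : ℝ} (hr : r ∈ Ioo (0 : ℝ) 2) : 0 < Real.sin (Real.pi * r / 2) :=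
  Real.sin_pos_of_pos_of_lt_pi (by have := Real.pi_pos; have := hr.1; positivity)
    (by nlinarith [Real.pi_pos, hr.2])

/-- The density u/φ times the normal component -φ equals -u: φ cancels, and the mean curvature is a
multiple of u'. The sign is negative because the height decreases with r. -/
theorem isClosedMinimalSurface_radialTorus (hw : IsWarpingPair u φ) {c : ℝ}
    (hc : c ∈ Ioo (0 : ℝ) 2) (hu : deriv u c = 0) :
    IsClosedMinimalSurface (warpedMetric u φ) (radialTorus c) where
  isClosed := isClosed_eq contMDiff_height.continuous continuous_const
  nonempty := ⟨coordMap ![c, 0, 0], by simp [radialTorus]⟩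
  minimal := by
    intro p hp
    refine ⟨univ, fun q => height q - Real.cos (Real.pi * c / 2), mem_univ _, ?_, ?_⟩
    · have hs : ContMDiff modelM 𝓘(ℝ, ℝ) ∞ (fun q => height q - Real.cos (Real.pi * c / 2)) :=
        contMDiff_height.sub contMDiff_const
      refine ⟨isOpen_univ, hs.contMDiffOn, ?_, ?_⟩
      · rintro q ⟨hq, -⟩
        obtain ⟨θ, ξ, rfl⟩ := exists_radius (Ioo_subset_Icc_self hc) hq
        refine mfderiv_ne_zero_of_curve (y := fun t => ![t, θ, ξ]) (t := c)
          (D := -(Real.sin (Real.pi * c / 2) * (Real.pi / 2))) ?_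
          (hs.mdifferentiableAt (by simp)) ?_ ?_
        · rw [contDiff_pi]
          intro i
          fin_cases i <;> simp <;> fun_prop
        · simpa using (hasDerivAt_cos_radius c).sub_const (Real.cos (Real.pi * c / 2))
        · have := sin_radius_pos hc
          have := Real.pi_pos
          rw [neg_ne_zero]
          positivity
      · ext q
        simp [radialTorus, sub_eq_zero]
    · rintro x hx ⟨hxS, -⟩
      have hxc : x 0 = c := by
        have h : Real.cos (Real.pi * x 0 / 2) = Real.cos (Real.pi * c / 2) := by
          simpa [radialTorus] using hxS
        have hpi := Real.pi_pos
        have := Real.injOn_cos ⟨by nlinarith [hx.1], by nlinarith [hx.2]⟩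
          ⟨by nlinarith [hc.1], by nlinarith [hc.2]⟩ h
        nlinarith
      set F : Coord → ℝ := (fun q => height q - Real.cos (Real.pi * c / 2)) ∘ coordMap with hFdef
      have hF : ∀ y a, pd a F y = if 0 = a then
          -(Real.sin (Real.pi * y 0 / 2) * (Real.pi / 2)) else 0 := fun y a => by
        have h := (hasDerivAt_cos_radius (y 0)).sub_const (Real.cos (Real.pi * c / 2))
        have h' : F = fun y => Real.cos (Real.pi * y 0 / 2) - Real.cos (Real.pi * c / 2) := by
          funext y
          simp [F]
        rw [h', pd_comp_coord (w := fun s => Real.cos (Real.pi * s / 2) - Real.cos (Real.pi * c / 2))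
          h.differentiableAt, h.deriv]
      have hflux : ∀ i, (fun y => √ (warpedMetric u φ y).det *
          ((∑ j, (warpedMetric u φ y)⁻¹ i j * pd j F y) / gradNorm (warpedMetric u φ) F y))
          =ᶠ[𝓝 x] fun y => if i = 0 then -u (y 0) else 0 := fun i => by
        filter_upwards [isOpen_strip.mem_nhds hx] with y hy
        have hup := hw.u_pos _ hy
        have hφ := hw.φ_pos (polarPt (y 0) (y 1))
        rw [normal_of_radial hw.φ_pos hup.ne' (D := -(Real.sin (Real.pi * y 0 / 2) * (Real.pi / 2)))
          _ (hF y), sqrt_det_warpedMetric hw.φ_pos hup.le]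
        · split_ifs
          · field_simp
          · simp
        · have := sin_radius_pos hy
          have := Real.pi_pos
          rw [neg_lt_zero]
          positivity
      have hz : ∀ i, pd i (fun y => √ (warpedMetric u φ y).det *
          ((∑ j, (warpedMetric u φ y)⁻¹ i j * pd j F y) / gradNorm (warpedMetric u φ) F y)) x = 0 := by
        intro i
        rw [pd_congr (hflux i)]
        by_cases hi : i = 0
        · subst hi
          simp only [if_true, pd_neg]
          rw [pd_comp_coord (hw.differentiableAt hx), hxc, hu]
          simp
        · simp only [hi, if_false, pd_const]
      rw [meanCurvature]
      simp only [hz]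
      simp

/-- The sphere `ξ = 0`. -/
def zeroSphere : Set M := {p | p.2 = 1}

/-- The sine of the angle `ξ`. -/
def fiberSin (p : M) : ℝ := (p.2 : ℂ).im

lemma contMDiff_fiberSin : ContMDiff modelM 𝓘(ℝ, ℝ) ∞ fiberSin := by
  have : Fact (Module.finrank ℝ ℂ = 1 + 1) := ⟨by simp⟩
  have h1 : ContMDiff (M := Circle) (𝓡 1) 𝓘(ℝ, ℂ) ∞ (fun z : Circle => (z : ℂ)) :=
    contMDiff_coe_sphere (E := ℂ) (n := 1)
  have h2 : ContDiff ℝ ∞ (fun z : ℂ => z.im) := Complex.imCLM.contDiff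
  exact (h2.contMDiff.comp h1).comp contMDiff_snd

lemma fiberSin_coordMap (x : Coord) : fiberSin (coordMap x) = Real.sin (x 2) := by
  simp [fiberSin, coordMap, Circle.coe_exp, Complex.exp_ofReal_mul_I_im]

/-- The metric does not depend on ξ, so neither does the flux u/φ² of the unit normal, and its
divergence vanishes. -/
theorem isClosedMinimalSurface_zeroSphere (hw : IsWarpingPair u φ) :
    IsClosedMinimalSurface (warpedMetric u φ) zeroSphere where
  isClosed := isClosed_eq continuous_snd continuous_const
  nonempty := ⟨coordMap ![1, 0, 0], by simp [zeroSphere, coordMap]⟩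
  minimal := by
    intro p hp
    have hopen : IsOpen {q : M | 0 < (q.2 : ℂ).re} :=
      isOpen_lt continuous_const (Complex.continuous_re.comp
        (continuous_subtype_val.comp continuous_snd))
    -- The function sin ξ also vanishes at ξ = π; the half cos ξ > 0 excludes that second sphere.
    refine ⟨{q | 0 < (q.2 : ℂ).re}, fiberSin, ?_, ?_, ?_⟩
    · have : p.2 = 1 := hp
      simp [this]
    · refine ⟨hopen, contMDiff_fiberSin.contMDiffOn, ?_, ?_⟩
      · rintro ⟨q, z⟩ ⟨hq, -⟩
        have hz : z = 1 := hq
        subst hz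
        obtain ⟨x, hx⟩ := exists_coord (q, 1)
        have hxy : coordMap ![x 0, x 1, 0] = (q, 1) := by
          rw [← hx]
          refine Prod.ext rfl ?_
          have := congrArg Prod.snd hx
          simp only [coordMap] at this ⊢
          rw [this]
          simp
        rw [← hxy]
        refine mfderiv_ne_zero_of_curve (y := fun t => ![x 0, x 1, t]) (t := 0) (D := 1) ?_
          (contMDiff_fiberSin.mdifferentiableAt (by simp)) ?_ one_ne_zero
        · rw [contDiff_pi]
          intro i
          fin_cases i <;> simp <;> fun_prop
        · simpa [fiberSin_coordMap] using Real.hasDerivAt_sin 0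
      · ext ⟨q, z⟩
        simp only [zeroSphere, fiberSin, mem_inter_iff, mem_ofPred_eq]
        refine ⟨fun h => ⟨h.2, by simp [h.1]⟩, fun h => ⟨?_, h.1⟩⟩
        have h1 : (z : ℂ).re ^ 2 = 1 := by
          have := Circle.normSq_coe z
          rw [Complex.normSq_apply, h.2] at this
          nlinarith
        ext
        apply Complex.ext
        · simp; nlinarith [h.1]
        · simp [h.2]
    · rintro x hx ⟨hxS, hxW⟩
      have hcos : ∀ y : Coord, ((coordMap y).2 : ℂ).re = Real.cos (y 2) := fun y => by
        simp [coordMap, Circle.coe_exp, Complex.exp_ofReal_mul_I_re]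
      have hF : ∀ y a, pd a (fiberSin ∘ coordMap) y = if 2 = a then Real.cos (y 2) else 0 :=
        fun y a => by
        have h' : fiberSin ∘ coordMap = fun y => Real.sin (y 2) := by
          funext y
          simp [fiberSin_coordMap]
        rw [h', pd_comp_coord Real.differentiableAt_sin, Real.deriv_sin]
      have hflux : ∀ i, (fun y => √ (warpedMetric u φ y).det *
          ((∑ j, (warpedMetric u φ y)⁻¹ i j * pd j (fiberSin ∘ coordMap) y) /
            gradNorm (warpedMetric u φ) (fiberSin ∘ coordMap) y)) =ᶠ[𝓝 x]
          fun y => if i = 2 then u (y 0) / φ (polarPt (y 0) (y 1)) ^ 2 else 0 := fun i => by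
        have hW : ∀ᶠ y : Coord in 𝓝 x, 0 < Real.cos (y 2) := by
          have hx0 : 0 < Real.cos (x 2) := by
            rw [← hcos]
            exact hxW
          exact (isOpen_lt continuous_const (by fun_prop)).mem_nhds hx0
        filter_upwards [isOpen_strip.mem_nhds hx, hW] with y hy hyW
        have hup := hw.u_pos _ hy
        have hφ := hw.φ_pos (polarPt (y 0) (y 1))
        rw [normal_of_fiber hw.φ_pos hup.ne' hyW (hF y), sqrt_det_warpedMetric hw.φ_pos hup.le]
        split_ifs
        · field_simp
        · simp
      have hz : ∀ i, pd i (fun y => √ (warpedMetric u φ y).det *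
          ((∑ j, (warpedMetric u φ y)⁻¹ i j * pd j (fiberSin ∘ coordMap) y) /
            gradNorm (warpedMetric u φ) (fiberSin ∘ coordMap) y)) x = 0 := by
        intro i
        rw [pd_congr (hflux i)]
        by_cases hi : i = 2
        · subst hi
          exact pd_eq_zero (by simp)
        · simp only [hi, if_false, pd_const]
      rw [meanCurvature]
      simp only [hz]
      simp

end MinimalSurfaces

/-! ### Area and volume bounds -/

section AreaVolume

variable {u : ℝ → ℝ} {φ : S2 → ℝ}

/-- Only upper bounds on areas are ever needed, so a single chart covering the surface is enough,
injective or not. The remaining pieces are empty. -/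
lemma area_le_of_single_chart {G : CoordTensor} {S : Set M} {U : Set (Fin 2 → ℝ)}
    {Y : (Fin 2 → ℝ) → Coord} {B : Set (Fin 2 → ℝ)} (hU : IsOpen U) (hY : ContDiffOn ℝ ∞ Y U)
    (hm : MapsTo Y U strip) (hB : B ⊆ U) (hBm : MeasurableSet B)
    (hS : (coordMap ∘ Y) '' B = S ∩ coordMap '' strip) :
    area G S ≤ ∫⁻ s in B, ENNReal.ofReal (areaDensity G Y s) := by
  have hP : IsParametrization S (fun _ => U) (fun _ => Y) (fun n => if n = 0 then B else ∅) := by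
    refine ⟨fun _ => hU, fun _ => hY, fun _ => hm, fun n => ?_, fun n => ?_, ?_⟩
    · split_ifs; exacts [hB, empty_subset _]
    · split_ifs; exacts [hBm, MeasurableSet.empty]
    · rw [← hS]
      ext p
      simp only [mem_iUnion]
      constructor
      · rintro ⟨n, hn⟩
        split_ifs at hn
        · exact hn
        · simp at hn
      · exact fun h => ⟨0, by simpa using h⟩
  unfold area
  refine iInf_le_of_le (fun _ => U) (iInf_le_of_le (fun _ => Y)
    (iInf_le_of_le (fun n => if n = 0 then B else ∅) (iInf_le_of_le hP ?_)))
  rw [tsum_eq_single 0]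
  · simp
  · intro n hn
    simp [hn]

lemma hasFDerivAt_torusChart (c : ℝ) (s : Fin 2 → ℝ) :
    HasFDerivAt (fun s : Fin 2 → ℝ => (![c, s 0, s 1] : Coord))
      (ContinuousLinearMap.pi ![0, ContinuousLinearMap.proj (R := ℝ) (φ := fun _ : Fin 2 => ℝ) 0,
        ContinuousLinearMap.proj (R := ℝ) (φ := fun _ : Fin 2 => ℝ) 1] :
        (Fin 2 → ℝ) →L[ℝ] Coord) s := by
  rw [hasFDerivAt_pi']
  intro i
  fin_cases i
  · exact hasFDerivAt_const c s
  · exact (ContinuousLinearMap.proj 0 : (Fin 2 → ℝ) →L[ℝ] ℝ).hasFDerivAt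
  · exact (ContinuousLinearMap.proj 1 : (Fin 2 → ℝ) →L[ℝ] ℝ).hasFDerivAt

lemma hasFDerivAt_sphereChart (s : Fin 2 → ℝ) :
    HasFDerivAt (fun s : Fin 2 → ℝ => (![s 0, s 1, 0] : Coord))
      (ContinuousLinearMap.pi ![ContinuousLinearMap.proj (R := ℝ) (φ := fun _ : Fin 2 => ℝ) 0,
        ContinuousLinearMap.proj (R := ℝ) (φ := fun _ : Fin 2 => ℝ) 1, 0] :
        (Fin 2 → ℝ) →L[ℝ] Coord) s := by
  rw [hasFDerivAt_pi']
  intro i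
  fin_cases i
  · exact (ContinuousLinearMap.proj 0 : (Fin 2 → ℝ) →L[ℝ] ℝ).hasFDerivAt
  · exact (ContinuousLinearMap.proj 1 : (Fin 2 → ℝ) →L[ℝ] ℝ).hasFDerivAt
  · exact hasFDerivAt_const (0 : ℝ) s

/-- The θ-length carries 1/φ and the ξ-length carries φ, so φ drops out of the area of the torus. -/
lemma areaDensity_torusChart (hφ : ∀ q, 0 < φ q) {c : ℝ} (hu : 0 ≤ u c) (s : Fin 2 → ℝ) :
    areaDensity (warpedMetric u φ) (fun s => ![c, s 0, s 1]) s = u c := by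
  have h := hφ (polarPt c (s 0))
  rw [areaDensity, (hasFDerivAt_torusChart c s).fderiv, Matrix.det_fin_two,
    Real.sqrt_eq_iff_mul_self_eq _ hu]
  · simp [warpedMetric, dotProduct, Fin.sum_univ_three, Matrix.mulVec_diagonal]
    field_simp
  · simp [warpedMetric, dotProduct, Fin.sum_univ_three, Matrix.mulVec_diagonal]
    positivity

lemma areaDensity_sphereChart (hφ : ∀ q, 0 < φ q) {s : Fin 2 → ℝ} (hu : 0 ≤ u (s 0)) :
    areaDensity (warpedMetric u φ) (fun s => ![s 0, s 1, 0]) s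
      = u (s 0) / φ (polarPt (s 0) (s 1)) ^ 2 := by
  have h := hφ (polarPt (s 0) (s 1))
  rw [areaDensity, (hasFDerivAt_sphereChart s).fderiv, Matrix.det_fin_two,
    Real.sqrt_eq_iff_mul_self_eq _ (by positivity)]
  · simp [warpedMetric, dotProduct, Fin.sum_univ_three, Matrix.mulVec_diagonal]
    field_simp
  · simp [warpedMetric, dotProduct, Fin.sum_univ_three, Matrix.mulVec_diagonal]
    positivity

lemma exists_angle_circle (ξ : ℝ) : ∃ ξ' ∈ Icc 0 (2 * Real.pi), Circle.exp ξ' = Circle.exp ξ := by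
  obtain ⟨ξ', h, n, rfl⟩ := exists_angle ξ
  refine ⟨_, h, ?_⟩
  rw [Circle.exp_eq_exp]
  exact ⟨n, rfl⟩

lemma exists_angle_polarPt (r θ : ℝ) :
    ∃ θ' ∈ Icc 0 (2 * Real.pi), polarPt r θ' = polarPt r θ := by
  obtain ⟨θ', h, n, rfl⟩ := exists_angle θ
  exact ⟨_, h, polarPt_add_two_pi_mul r θ n⟩

lemma area_radialTorus_le (hw : IsWarpingPair u φ) {c : ℝ} (hc : c ∈ Ioo (0 : ℝ) 2) :
    area (warpedMetric u φ) (radialTorus c) ≤ ENNReal.ofReal (4 * Real.pi ^ 2 * u c) := by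
  have hpi := Real.pi_pos
  refine (area_le_of_single_chart (U := univ) (Y := fun s => ![c, s 0, s 1])
    (B := Icc (fun _ => 0) (fun _ => 2 * Real.pi)) isOpen_univ ?_ (fun s _ => hc) (subset_univ _)
    measurableSet_Icc ?_).trans ?_
  · rw [contDiffOn_univ, contDiff_pi]
    intro i
    fin_cases i <;> simp <;> fun_prop
  · ext p
    constructor
    · rintro ⟨s, -, rfl⟩
      exact ⟨by simp [radialTorus], _, hc, rfl⟩
    · rintro ⟨hp, -⟩
      obtain ⟨θ, ξ, rfl⟩ := exists_radius (Ioo_subset_Icc_self hc) hp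
      obtain ⟨θ', hθ, eθ⟩ := exists_angle_polarPt c θ
      obtain ⟨ξ', hξ, eξ⟩ := exists_angle_circle ξ
      refine ⟨![θ', ξ'], ?_, ?_⟩
      · constructor <;> intro i <;> fin_cases i <;> simp_all
      · simp [coordMap, eθ, eξ]
  · simp only [areaDensity_torusChart hw.φ_pos (hw.u_pos c hc).le]
    rw [setLIntegral_const, Real.volume_Icc_pi]
    have hu := (hw.u_pos c hc).le
    simp only [Fin.prod_univ_two, sub_zero]
    rw [← ENNReal.ofReal_mul (by positivity), ← ENNReal.ofReal_mul (by positivity)]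
    exact ENNReal.ofReal_le_ofReal (by nlinarith)

lemma area_zeroSphere_le (hw : IsWarpingPair u φ) {K : ℝ} (hK : 0 ≤ K)
    (h : ∀ r ∈ Ioo (0 : ℝ) 2, ∀ θ, u r / φ (polarPt r θ) ^ 2 ≤ K) :
    area (warpedMetric u φ) zeroSphere ≤ ENNReal.ofReal (4 * Real.pi * K) := by
  have hpi := Real.pi_pos
  have hBm : MeasurableSet ({s | s 0 ∈ Ioo 0 2 ∧ s 1 ∈ Icc 0 (2 * Real.pi)} : Set (Fin 2 → ℝ)) :=
    (measurableSet_Ioo.preimage (measurable_pi_apply 0)).inter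
      (measurableSet_Icc.preimage (measurable_pi_apply 1))
  refine (area_le_of_single_chart (U := {s | s 0 ∈ Ioo 0 2}) (Y := fun s => ![s 0, s 1, 0])
    (B := {s | s 0 ∈ Ioo 0 2 ∧ s 1 ∈ Icc 0 (2 * Real.pi)})
    (isOpen_Ioo.preimage (continuous_apply 0)) ?_ (fun s hs => hs) (fun s hs => hs.1)
    hBm ?_).trans ?_
  · apply ContDiff.contDiffOn
    rw [contDiff_pi]
    intro i
    fin_cases i <;> simp <;> fun_prop
  · ext p
    constructor
    · rintro ⟨s, hs, rfl⟩
      exact ⟨by simp [zeroSphere, coordMap], _, hs.1, rfl⟩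
    · rintro ⟨hp, x, hx, rfl⟩
      obtain ⟨θ', hθ, eθ⟩ := exists_angle_polarPt (x 0) (x 1)
      refine ⟨![x 0, θ'], ⟨hx, hθ⟩, ?_⟩
      have hp' : Circle.exp (x 2) = 1 := hp
      simp [coordMap, eθ, hp']
  · calc ∫⁻ s in {s : Fin 2 → ℝ | s 0 ∈ Ioo 0 2 ∧ s 1 ∈ Icc 0 (2 * Real.pi)},
          ENNReal.ofReal (areaDensity (warpedMetric u φ) (fun s => ![s 0, s 1, 0]) s)
        ≤ ∫⁻ s in {s : Fin 2 → ℝ | s 0 ∈ Ioo 0 2 ∧ s 1 ∈ Icc 0 (2 * Real.pi)},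
          ENNReal.ofReal K := by
          refine setLIntegral_mono' hBm fun s hs => ENNReal.ofReal_le_ofReal ?_
          rw [areaDensity_sphereChart hw.φ_pos (hw.u_pos _ hs.1).le]
          exact h _ hs.1 _
      _ ≤ ∫⁻ s in Icc (![0, 0] : Fin 2 → ℝ) ![2, 2 * Real.pi], ENNReal.ofReal K := by
          refine lintegral_mono_set fun s hs => ?_
          constructor <;> intro i <;> fin_cases i
          exacts [hs.1.1.le, hs.2.1, hs.1.2.le, hs.2.2]
      _ ≤ ENNReal.ofReal (4 * Real.pi * K) := by
          rw [setLIntegral_const, Real.volume_Icc_pi]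
          simp only [Fin.prod_univ_two, Matrix.cons_val_zero, Matrix.cons_val_one, sub_zero]
          rw [← ENNReal.ofReal_mul (by positivity), ← ENNReal.ofReal_mul (by positivity)]
          exact ENNReal.ofReal_le_ofReal (by nlinarith)

lemma measurableSet_box : MeasurableSet box :=
  (measurableSet_Ioo.preimage (measurable_pi_apply 0)).inter
    ((measurableSet_Ioo.preimage (measurable_pi_apply 1)).inter
      (measurableSet_Ioo.preimage (measurable_pi_apply 2)))

/-- Restricting to 1/2 < r < 3/2 stays away from the poles; that slab has coordinate volume 1 · 2π ·
2π. -/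
lemma le_vol_warpedMetric (hw : IsWarpingPair u φ) {m : ℝ}
    (h : ∀ r ∈ Ioo (1 / 2 : ℝ) (3 / 2), ∀ θ, m ≤ u r / φ (polarPt r θ)) :
    ENNReal.ofReal (4 * Real.pi ^ 2 * m) ≤ vol (warpedMetric u φ) := by
  have hpi := Real.pi_pos
  rcases le_total m 0 with hm | hm
  · rw [ENNReal.ofReal_of_nonpos (by have : 0 ≤ 4 * Real.pi ^ 2 := by positivity
                                     nlinarith)]
    exact zero_le
  rw [vol, volMeasure, withDensity_apply _ MeasurableSet.univ, Measure.restrict_univ]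
  set A : Set Coord := pi univ fun i => Ioo ((![1 / 2, 0, 0] : Coord) i)
    ((![3 / 2, 2 * Real.pi, 2 * Real.pi] : Coord) i) with hA
  have hAm : MeasurableSet A := MeasurableSet.univ_pi fun _ => measurableSet_Ioo
  have hmem : ∀ x ∈ A, x 0 ∈ Ioo (1 / 2 : ℝ) (3 / 2) ∧ x 1 ∈ Ioo 0 (2 * Real.pi) ∧
      x 2 ∈ Ioo 0 (2 * Real.pi) := fun x hx =>
    ⟨by simpa using hx 0 trivial, by simpa using hx 1 trivial, by simpa using hx 2 trivial⟩
  calc ENNReal.ofReal (4 * Real.pi ^ 2 * m) = ∫⁻ _ in A, ENNReal.ofReal m := by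
        rw [setLIntegral_const, hA, Real.volume_pi_Ioo]
        simp only [Fin.prod_univ_three]
        rw [← ENNReal.ofReal_mul (by norm_num), ← ENNReal.ofReal_mul (by norm_num; positivity),
          ← ENNReal.ofReal_mul hm]
        congr 1
        simp
        ring
    _ ≤ ∫⁻ x in A, ENNReal.ofReal (√ (warpedMetric u φ x).det) := by
        refine setLIntegral_mono' hAm fun x hx => ENNReal.ofReal_le_ofReal ?_
        obtain ⟨h0, -⟩ := hmem x hx
        rw [sqrt_det_warpedMetric hw.φ_pos
          (hw.u_pos _ ⟨by linarith [h0.1], by linarith [h0.2]⟩).le]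
        exact h _ h0 _
    _ ≤ ∫⁻ x in box, ENNReal.ofReal (√ (warpedMetric u φ x).det) := by
        refine lintegral_mono_set fun x hx => ?_
        obtain ⟨h0, h1, h2⟩ := hmem x hx
        exact ⟨⟨by linarith [h0.1], by linarith [h0.2]⟩, h1, h2⟩

end AreaVolume

/-! ### A priori estimates -/

section Estimates

variable {u : ℝ → ℝ} {φ : S2 → ℝ}

/-- The gradient bound for `log φ` that nonnegative scalar curvature amounts to. -/
def GradientBound (u : ℝ → ℝ) (φ : S2 → ℝ) : Prop :=
  ∀ r ∈ Ioo (0 : ℝ) 2, ∀ θ,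
    u r * deriv (fun s => logPolar φ s θ) r ^ 2 + deriv (fun t => logPolar φ r t) θ ^ 2 / u r
      ≤ -deriv (deriv u) r

lemma IsWarpingPair.deriv_deriv_nonpos (hw : IsWarpingPair u φ) (hg : GradientBound u φ) {r : ℝ}
    (hr : r ∈ Ioo (0 : ℝ) 2) : deriv (deriv u) r ≤ 0 := by
  have h := hg r hr 0
  have hu := hw.u_pos r hr
  have : 0 ≤ u r * deriv (fun s => logPolar φ s 0) r ^ 2
      + deriv (fun t => logPolar φ r t) 0 ^ 2 / u r := by positivity
  linarith

lemma derivWithin_eq_deriv {r : ℝ} (hr : r ∈ Ioo (0 : ℝ) 2) :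
    derivWithin u (Icc 0 2) r = deriv u r :=
  derivWithin_of_mem_nhds (Icc_mem_nhds hr.1 hr.2)

/-- With `derivWithin` the monotonicity reaches the poles, where the slopes 1 and -1 are prescribed;
these then bound the slope everywhere. -/
lemma IsWarpingPair.antitoneOn_derivWithin (hw : IsWarpingPair u φ) (hg : GradientBound u φ) :
    AntitoneOn (derivWithin u (Icc 0 2)) (Icc 0 2) := by
  have heq : ∀ r ∈ Ioo (0 : ℝ) 2, derivWithin u (Icc 0 2) =ᶠ[𝓝 r] deriv u := fun r hr => by
    filter_upwards [isOpen_Ioo.mem_nhds hr] with s hs using derivWithin_eq_deriv hs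
  refine antitoneOn_of_deriv_nonpos (convex_Icc 0 2)
    (hw.u_smooth.continuousOn_derivWithin (uniqueDiffOn_Icc two_pos) (by simp)) ?_ ?_
  · rw [interior_Icc]
    exact fun r hr => ((heq r hr).differentiableAt_iff.2
      (hw.differentiableAt_deriv hr)).differentiableWithinAt
  · rw [interior_Icc]
    intro r hr
    rw [(heq r hr).deriv_eq]
    exact hw.deriv_deriv_nonpos hg hr

lemma IsWarpingPair.abs_derivWithin_le (hw : IsWarpingPair u φ) (hg : GradientBound u φ) {r : ℝ}
    (hr : r ∈ Icc (0 : ℝ) 2) : |derivWithin u (Icc 0 2) r| ≤ 1 := by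
  have h0 := hw.antitoneOn_derivWithin hg (left_mem_Icc.2 zero_le_two) hr hr.1
  have h2 := hw.antitoneOn_derivWithin hg hr (right_mem_Icc.2 zero_le_two) hr.2
  rw [hw.deriv_zero] at h0
  rw [hw.deriv_two] at h2
  exact abs_le.2 ⟨h2, h0⟩

lemma IsWarpingPair.abs_deriv_le (hw : IsWarpingPair u φ) (hg : GradientBound u φ) {r : ℝ}
    (hr : r ∈ Ioo (0 : ℝ) 2) : |deriv u r| ≤ 1 := by
  rw [← derivWithin_eq_deriv hr]
  exact hw.abs_derivWithin_le hg (Ioo_subset_Icc_self hr)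

lemma IsWarpingPair.abs_sub_le (hw : IsWarpingPair u φ) (hg : GradientBound u φ) {r s : ℝ}
    (hr : r ∈ Icc (0 : ℝ) 2) (hs : s ∈ Icc (0 : ℝ) 2) : |u r - u s| ≤ |r - s| := by
  have h := (convex_Icc (0 : ℝ) 2).norm_image_sub_le_of_norm_derivWithin_le
    (hw.u_smooth.differentiableOn (by simp)) (fun x hx => hw.abs_derivWithin_le hg hx) hs hr
  simpa using h

lemma IsWarpingPair.u_nonneg (hw : IsWarpingPair u φ) {r : ℝ} (hr : r ∈ Icc (0 : ℝ) 2) :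
    0 ≤ u r := by
  rcases eq_or_lt_of_le hr.1 with h | h
  · rw [← h, hw.u_zero]
  rcases eq_or_lt_of_le hr.2 with h' | h'
  · rw [h', hw.u_two]
  exact (hw.u_pos r ⟨h, h'⟩).le

lemma IsWarpingPair.u_le (hw : IsWarpingPair u φ) (hg : GradientBound u φ) {r : ℝ}
    (hr : r ∈ Icc (0 : ℝ) 2) : u r ≤ r ∧ u r ≤ 2 - r := by
  have h0 := hw.abs_sub_le hg hr (left_mem_Icc.2 zero_le_two)
  have h2 := hw.abs_sub_le hg hr (right_mem_Icc.2 zero_le_two)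
  rw [hw.u_zero, sub_zero, sub_zero, abs_of_nonneg hr.1] at h0
  rw [hw.u_two, sub_zero, abs_sub_comm, abs_of_nonneg (by linarith [hr.2] : (0 : ℝ) ≤ 2 - r)] at h2
  exact ⟨(le_abs_self _).trans h0, (le_abs_self _).trans h2⟩

/-- The larger of r and 2 - r is at least 1, so the smaller one is at most their product. -/
lemma IsWarpingPair.u_le_mul (hw : IsWarpingPair u φ) (hg : GradientBound u φ) {r : ℝ}
    (hr : r ∈ Icc (0 : ℝ) 2) : u r ≤ r * (2 - r) := by
  obtain ⟨h1, h2⟩ := hw.u_le hg hr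
  rcases le_total r 1 with h | h
  · nlinarith [hr.1]
  · nlinarith [hr.2]

lemma IsWarpingPair.concaveOn (hw : IsWarpingPair u φ) (hg : GradientBound u φ) :
    ConcaveOn ℝ (Icc 0 2) u := by
  refine AntitoneOn.concaveOn_of_deriv (convex_Icc 0 2) hw.u_smooth.continuousOn ?_ ?_
  · rw [interior_Icc]
    exact fun r hr => (hw.differentiableAt hr).differentiableWithinAt
  · rw [interior_Icc]
    intro r hr s hs hrs
    rw [← derivWithin_eq_deriv hr, ← derivWithin_eq_deriv hs]
    exact hw.antitoneOn_derivWithin hg (Ioo_subset_Icc_self hr) (Ioo_subset_Icc_self hs) hrs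

/-- The area bound on minimal tori keeps `u` away from zero. -/
lemma IsWarpingPair.lower_bound (hw : IsWarpingPair u φ) (hg : GradientBound u φ) {A₀ : ℝ}
    (hA : ENNReal.ofReal A₀ ≤ minA (warpedMetric u φ)) {r : ℝ}
    (hr : r ∈ Icc (0 : ℝ) 2) : A₀ / (16 * Real.pi ^ 2) * (r * (2 - r)) ≤ u r := by
  have hpi := Real.pi_pos
  -- Rolle's theorem provides the critical radius, hence a minimal torus.
  obtain ⟨c, hc, hdc⟩ := exists_deriv_eq_zero two_pos hw.u_smooth.continuousOn
    (hw.u_zero.trans hw.u_two.symm)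
  have huc := hw.u_pos c hc
  have hAc : A₀ ≤ 4 * Real.pi ^ 2 * u c := by
    have h : ENNReal.ofReal A₀ ≤ ENNReal.ofReal (4 * Real.pi ^ 2 * u c) :=
      hA.trans ((iInf₂_le _ (isClosedMinimalSurface_radialTorus hw hc hdc)).trans
        (area_radialTorus_le hw hc))
    exact (ENNReal.ofReal_le_ofReal_iff (by positivity)).1 h
  -- Here 16π² = 4 · 4π². The extra 4 comes from concavity: for r ≤ c, u(r) ≥ u(c) r/c ≥ u(c) r/2 ≥
  -- u(c) r(2 - r)/4, and symmetrically beyond c.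
  have hk : A₀ / (16 * Real.pi ^ 2) ≤ u c / 4 := by
    rw [div_le_div_iff₀ (by positivity) (by positivity)]
    linarith
  have hrr : 0 ≤ r * (2 - r) := mul_nonneg hr.1 (by linarith [hr.2])
  refine (mul_le_mul_of_nonneg_right hk hrr).trans ?_
  have hconc := hw.concaveOn hg
  rcases le_total r c with h | h
  · have h1 := hconc.2 (left_mem_Icc.2 zero_le_two) (Ioo_subset_Icc_self hc)
      (show 0 ≤ 1 - r / c by rw [sub_nonneg, div_le_one hc.1]; exact h)
      (div_nonneg hr.1 hc.1.le) (by ring)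
    have h2 : r / c * c = r := div_mul_cancel₀ _ hc.1.ne'
    simp only [smul_eq_mul, mul_zero, zero_add, hw.u_zero, h2] at h1
    have h3 : r / 2 ≤ r / c := div_le_div_of_nonneg_left hr.1 hc.1 hc.2.le
    nlinarith [hr.1, hr.2, mul_le_mul_of_nonneg_right h3 huc.le, mul_nonneg hr.1 huc.le,
      mul_nonneg (mul_nonneg hr.1 huc.le) hr.1]
  · have hc2 : 0 < 2 - c := by linarith [hc.2]
    have hr2 : 0 ≤ 2 - r := by linarith [hr.2]
    have h1 := hconc.2 (right_mem_Icc.2 zero_le_two) (Ioo_subset_Icc_self hc)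
      (show 0 ≤ 1 - (2 - r) / (2 - c) by rw [sub_nonneg, div_le_one hc2]; linarith)
      (div_nonneg hr2 hc2.le) (by ring)
    have h2 : (1 - (2 - r) / (2 - c)) * 2 + (2 - r) / (2 - c) * c = r := by
      field_simp
      ring
    simp only [smul_eq_mul, hw.u_two, h2, mul_zero, zero_add] at h1
    have h3 : (2 - r) / 2 ≤ (2 - r) / (2 - c) :=
      div_le_div_of_nonneg_left hr2 hc2 (by linarith [hc.1])
    nlinarith [mul_le_mul_of_nonneg_right h3 huc.le, mul_nonneg hr2 huc.le,
      mul_nonneg (mul_nonneg hr2 huc.le) hr2]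

/-- A primitive of `2 / (r (2 - r))`. -/
def logRatio (r : ℝ) : ℝ := Real.log r - Real.log (2 - r)

lemma hasDerivAt_logRatio {r : ℝ} (hr : r ∈ Ioo (0 : ℝ) 2) :
    HasDerivAt logRatio (2 / (r * (2 - r))) r := by
  have h2 : (2 - r) ≠ 0 := by linarith [hr.2]
  have h0 : r ≠ 0 := hr.1.ne'
  have h := (Real.hasDerivAt_log h0).sub (((hasDerivAt_id r).const_sub 2).log h2)
  refine h.congr_deriv ?_
  simp
  field_simp
  ring

lemma logRatio_one : logRatio 1 = 0 := by norm_num [logRatio]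

/-- The left side is the larger of r/(2 - r) and its inverse, that is, the square of the larger of
r, 2 - r over their product. This turns growth in `logRatio` into a singularity integrable over the
sphere. -/
lemma exp_abs_logRatio_le {r : ℝ} (hr : r ∈ Ioo (0 : ℝ) 2) :
    Real.exp |logRatio r| ≤ 4 / (r * (2 - r)) := by
  have h0 := hr.1
  have h2 : 0 < 2 - r := by linarith [hr.2]
  rcases abs_cases (logRatio r) with ⟨h, -⟩ | ⟨h, -⟩
  · rw [h, logRatio, Real.exp_sub, Real.exp_log h0, Real.exp_log h2,
      div_le_div_iff₀ h2 (by positivity)]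
    nlinarith [mul_pos h0 h2]
  · rw [h, logRatio, neg_sub, Real.exp_sub, Real.exp_log h0, Real.exp_log h2,
      div_le_div_iff₀ h0 (by positivity)]
    nlinarith [mul_pos h0 h2]

/-- A function whose derivative is dominated by that of `g` oscillates less than `g`. -/
lemma abs_sub_le_of_abs_deriv_le {a b : ℝ} {f g : ℝ → ℝ}
    (hf : ∀ r ∈ Ioo a b, DifferentiableAt ℝ f r) (hg : ∀ r ∈ Ioo a b, DifferentiableAt ℝ g r)
    (h : ∀ r ∈ Ioo a b, |deriv f r| ≤ deriv g r) {s r : ℝ} (hs : s ∈ Ioo a b) (hr : r ∈ Ioo a b)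
    (hsr : s ≤ r) : |f r - f s| ≤ g r - g s := by
  have key : ∀ F : ℝ → ℝ, (∀ r ∈ Ioo a b, DifferentiableAt ℝ F r) →
      (∀ r ∈ Ioo a b, deriv F r ≤ deriv g r) → F r - F s ≤ g r - g s := fun F hF hFg => by
    have hd : ∀ r ∈ Ioo a b, DifferentiableAt ℝ (fun x => F x - g x) r := fun r hr =>
      (hF r hr).fun_sub (hg r hr)
    have := antitoneOn_of_deriv_nonpos (f := fun x => F x - g x) (convex_Ioo a b)
      (fun r hr => (hd r hr).continuousAt.continuousWithinAt)
      (fun r hr => (hd r (interior_subset hr)).differentiableWithinAt)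
      (fun r hr => by
        have hr' := interior_subset hr
        rw [deriv_fun_sub (hF r hr') (hg r hr')]
        linarith [hFg r hr']) hs hr hsr
    dsimp only at this
    linarith
  have h1 := key f hf fun r hr => (le_abs_self _).trans (h r hr)
  have h2 := key (fun x => -f x) (fun r hr => (hf r hr).fun_neg) fun r hr => by
    rw [deriv.fun_neg]
    exact (neg_le_abs _).trans (h r hr)
  exact abs_le.2 ⟨by linarith, h1⟩

/-- Oscillation bounds for a function of polar coordinates, uniform away from the poles. -/
structure OscillationBound (κ : ℝ) (F : ℝ → ℝ → ℝ) : Prop where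
  radial : ∀ θ, ∀ r ∈ Ioo (0 : ℝ) 2, ∀ s ∈ Ioo (0 : ℝ) 2, ∀ t > 0,
    |F r θ - F s θ| ≤ t + |logRatio r - logRatio s| / (4 * t * κ)
  angular : ∀ r ∈ Ioo (0 : ℝ) 2, ∀ δ > 0, r + δ < 2 → ∀ t > 0, ∀ θ θ',
    |F r θ - F r θ'| ≤ 2 * (t + |logRatio (r + δ) - logRatio r| / (4 * t * κ))
      + (1 + 2 / δ) * |θ - θ'|
  periodic : ∀ r θ, ∀ n : ℤ, F r (θ + n * (2 * Real.pi)) = F r θ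

/-- The radial derivative is dominated by the derivative of -(t/2) u' + `logRatio` / (4tκ). The
first term varies by at most t, because |u'| ≤ 1. -/
lemma IsWarpingPair.abs_radial_sub_le (hw : IsWarpingPair u φ) (hg : GradientBound u φ) {κ : ℝ}
    (hκ : 0 < κ) (hu : ∀ r ∈ Icc (0 : ℝ) 2, κ * (r * (2 - r)) ≤ u r) (θ : ℝ) {r s t : ℝ}
    (hr : r ∈ Ioo (0 : ℝ) 2) (hs : s ∈ Ioo (0 : ℝ) 2) (ht : 0 < t) (hsr : s ≤ r) :
    |logPolar φ r θ - logPolar φ s θ| ≤ t + (logRatio r - logRatio s) / (4 * t * κ) := by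
  have hf : ContDiff ℝ ∞ fun s => logPolar φ s θ := hw.contDiff_logPolar contDiff_id contDiff_const
  have hgd : ∀ x ∈ Ioo (0 : ℝ) 2, HasDerivAt
      (fun x => -(t / 2 * deriv u x) + logRatio x / (4 * t * κ))
      (-(t / 2 * deriv (deriv u) x) + 2 / (x * (2 - x)) / (4 * t * κ)) x := fun x hx =>
    ((hw.differentiableAt_deriv hx).hasDerivAt.const_mul (t / 2)).fun_neg.fun_add
      ((hasDerivAt_logRatio hx).div_const _)
  have h := abs_sub_le_of_abs_deriv_le (f := fun s => logPolar φ s θ)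
    (fun x _ => (hf.differentiable (by simp)).differentiableAt)
    (fun x hx => (hgd x hx).differentiableAt) (fun x hx => ?_) hs hr hsr
  · refine h.trans ?_
    have h1 := (abs_le.1 (hw.abs_deriv_le hg hr)).1
    have h2 := (abs_le.1 (hw.abs_deriv_le hg hs)).2
    rw [sub_div]
    nlinarith
  · rw [(hgd x hx).deriv]
    have hup := hw.u_pos x hx
    have hb := hg x hx θ
    have hux := hu x (Ioo_subset_Icc_self hx)
    have hxx : 0 < x * (2 - x) := mul_pos hx.1 (by linarith [hx.2])
    set d := deriv (fun s => logPolar φ s θ) x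
    have h0 : 0 ≤ deriv (fun t => logPolar φ x t) θ ^ 2 / u x := by positivity
    have h1 : u x * d ^ 2 ≤ -deriv (deriv u) x := by linarith
    have h2 : 1 / u x ≤ 1 / (κ * (x * (2 - x))) := one_div_le_one_div_of_le (by positivity) hux
    have h3 : 2 / (x * (2 - x)) / (4 * t * κ) = 1 / (2 * t) * (1 / (κ * (x * (2 - x)))) := by
      have : x * (2 - x) ≠ 0 := hxx.ne'
      generalize x * (2 - x) = y at *
      field_simp
      norm_num
    have h4 : 1 / (2 * t) * (1 / u x) ≤ 1 / (2 * t) * (1 / (κ * (x * (2 - x)))) :=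
      mul_le_mul_of_nonneg_left h2 (by positivity)
    -- The difference of the two sides is the square (t u |d| - 1)² over 2tu.
    have h5 : |d| ≤ t / 2 * (u x * d ^ 2) + 1 / (2 * t) * (1 / u x) := by
      have : t / 2 * (u x * d ^ 2) + 1 / (2 * t) * (1 / u x) - |d|
          = (t * u x * |d| - 1) ^ 2 / (2 * t * u x) := by
        rw [← sq_abs d]
        field_simp
        ring
      have h6 : 0 ≤ (t * u x * |d| - 1) ^ 2 / (2 * t * u x) := by positivity
      linarith
    have h7 := mul_le_mul_of_nonneg_left h1 (by positivity : 0 ≤ t / 2)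
    rw [h3]
    linarith

lemma logRatio_monotone {s r : ℝ} (hs : s ∈ Ioo (0 : ℝ) 2) (hr : r ∈ Ioo (0 : ℝ) 2) (h : s ≤ r) :
    logRatio s ≤ logRatio r := by
  have h1 := Real.log_le_log hs.1 h
  have h2 := Real.log_le_log (by linarith [hr.2] : 0 < 2 - r) (by linarith : 2 - r ≤ 2 - s)
  unfold logRatio
  linarith

/-- On a given circle f_θ is not controlled, since -u'' may be large there. By the mean value
theorem for u', some circle r = s in (r, r + δ) has -u''(s) ≤ 2/δ, which bounds f_θ. The two points
are joined by going radially to that circle, along it, and radially back; hence the factor 2. -/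
theorem IsWarpingPair.oscillationBound (hw : IsWarpingPair u φ) (hg : GradientBound u φ) {κ : ℝ}
    (hκ : 0 < κ) (hu : ∀ r ∈ Icc (0 : ℝ) 2, κ * (r * (2 - r)) ≤ u r) :
    OscillationBound κ (logPolar φ) := by
  have hrad : ∀ θ, ∀ r ∈ Ioo (0 : ℝ) 2, ∀ s ∈ Ioo (0 : ℝ) 2, ∀ t > 0,
      |logPolar φ r θ - logPolar φ s θ| ≤ t + |logRatio r - logRatio s| / (4 * t * κ) := by
    intro θ r hr s hs t ht
    rcases le_total s r with h | h
    · rw [abs_of_nonneg (sub_nonneg.2 (logRatio_monotone hs hr h))]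
      exact hw.abs_radial_sub_le hg hκ hu θ hr hs ht h
    · rw [abs_sub_comm, abs_sub_comm (logRatio r),
        abs_of_nonneg (sub_nonneg.2 (logRatio_monotone hr hs h))]
      exact hw.abs_radial_sub_le hg hκ hu θ hs hr ht h
  refine ⟨hrad, ?_, fun r θ n => logPolar_periodic r θ n⟩
  intro r hr δ hδ hrδ t ht θ θ'
  have hsub : Icc r (r + δ) ⊆ Ioo (0 : ℝ) 2 := fun x hx =>
    ⟨hr.1.trans_le hx.1, hx.2.trans_lt hrδ⟩
  obtain ⟨s, hs, hds⟩ := exists_deriv_eq_slope (deriv u) (lt_add_of_pos_right r hδ)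
    (fun x hx => (hw.differentiableAt_deriv (hsub hx)).continuousAt.continuousWithinAt)
    (fun x hx => (hw.differentiableAt_deriv
      (hsub (Ioo_subset_Icc_self hx))).differentiableWithinAt)
  have hs2 := hsub (Ioo_subset_Icc_self hs)
  have hrδ2 := hsub (right_mem_Icc.2 (le_add_of_nonneg_right hδ.le))
  have hus : u s ≤ 1 := by
    obtain ⟨h1, h2⟩ := hw.u_le hg (Ioo_subset_Icc_self hs2)
    linarith
  have hup := hw.u_pos s hs2
  have hdd : -deriv (deriv u) s ≤ 2 / δ := by
    rw [hds, add_sub_cancel_left, ← neg_div]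
    have h1 := (abs_le.1 (hw.abs_deriv_le hg hr)).2
    have h2 := (abs_le.1 (hw.abs_deriv_le hg hrδ2)).1
    gcongr
    linarith
  have hfθ : ContDiff ℝ ∞ fun t => logPolar φ s t := hw.contDiff_logPolar contDiff_const contDiff_id
  have hang : |logPolar φ s θ - logPolar φ s θ'| ≤ (1 + 2 / δ) * |θ - θ'| := by
    have := (convex_univ (𝕜 := ℝ) (E := ℝ)).norm_image_sub_le_of_norm_deriv_le
      (f := fun t => logPolar φ s t) (C := 1 + 2 / δ) (x := θ') (y := θ)
      (fun x _ => (hfθ.differentiable (by simp)).differentiableAt) (fun x _ => ?_) trivial trivial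
    · simpa using this
    · have hb := hg s hs2 x
      rw [Real.norm_eq_abs]
      set d := deriv (fun t => logPolar φ s t) x
      have h0 : 0 ≤ u s * deriv (fun y => logPolar φ y x) s ^ 2 := by positivity
      have h1 : d ^ 2 / u s ≤ 2 / δ := by linarith
      have h2 : d ^ 2 ≤ d ^ 2 / u s := by
        rw [le_div_iff₀ hup]
        nlinarith [sq_nonneg d]
      -- Here |d| ≤ 1 + d², which trades the square root of 2/δ for the simpler constant 1 + 2/δ.
      nlinarith [sq_abs d, sq_nonneg (|d| - 1)]
  have hmono : |logRatio s - logRatio r| ≤ |logRatio (r + δ) - logRatio r| := by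
    have h1 := logRatio_monotone hr hs2 hs.1.le
    have h2 := logRatio_monotone hs2 hrδ2 hs.2.le
    rw [abs_of_nonneg (by linarith), abs_of_nonneg (by linarith)]
    linarith
  have hq : |logRatio s - logRatio r| / (4 * t * κ)
      ≤ |logRatio (r + δ) - logRatio r| / (4 * t * κ) := by gcongr
  have e1 := hrad θ s hs2 r hr t ht
  have e2 := hrad θ' s hs2 r hr t ht
  rw [abs_le] at e1 e2 hang ⊢
  constructor <;> linarith [e1.1, e1.2, e2.1, e2.2, hang.1, hang.2]

/-- The parameter t is chosen so that 1/(4tκ) = η: a small coefficient of `logRatio` is paid for by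
a large constant. The angle is dealt with once, on the equator, after reduction to one period. -/
lemma OscillationBound.exists_abs_sub_le {κ η : ℝ} (hκ : 0 < κ) (hη : 0 < η) :
    ∃ K : ℝ, ∀ F, OscillationBound κ F → ∀ r ∈ Ioo (0 : ℝ) 2, ∀ θ,
      |F r θ - F 1 0| ≤ K + η * |logRatio r| := by
  set t := 1 / (4 * η * κ) with ht
  have htp : 0 < t := by positivity
  have h4 : 4 * t * κ = 1 / η := by rw [ht]; field_simp
  refine ⟨t + (2 * (t + |logRatio (1 + 1 / 2) - logRatio 1| / (4 * t * κ))
      + (1 + 2 / (1 / 2)) * (2 * Real.pi)), fun F hF r hr θ => ?_⟩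
  obtain ⟨θ', hθ', n, hn⟩ := exists_angle θ
  have h1 := hF.radial θ' r hr 1 (by norm_num) t htp
  have h2 := hF.angular 1 (by norm_num) (1 / 2) (by norm_num) (by norm_num) t htp θ' 0
  have h3 : |θ' - 0| ≤ 2 * Real.pi := by
    rw [sub_zero, abs_of_nonneg hθ'.1]
    exact hθ'.2
  have h5 : F r θ = F r θ' := by rw [hn, hF.periodic]
  rw [h4, logRatio_one, sub_zero, div_div_eq_mul_div, div_one, mul_comm |logRatio r|] at h1
  rw [h5]
  rw [abs_le] at h1 h2 ⊢
  constructor <;> linarith [h1.1, h1.2, h2.1, h2.2]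

/-- The volume and the area of the sphere `ξ = 0` control `log φ` on the equator. -/
theorem exists_abs_logPolar_one_le {κ A₀ : ℝ} (hκ : 0 < κ) (hA₀ : 0 < A₀) (V₀ : ℝ) :
    ∃ C : ℝ, ∀ (u : ℝ → ℝ) (φ : S2 → ℝ), IsWarpingPair u φ → GradientBound u φ →
      (∀ r ∈ Icc (0 : ℝ) 2, κ * (r * (2 - r)) ≤ u r) →
      vol (warpedMetric u φ) ≤ ENNReal.ofReal V₀ →
      ENNReal.ofReal A₀ ≤ minA (warpedMetric u φ) → |logPolar φ 1 0| ≤ C := by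
  obtain ⟨K, hK⟩ := OscillationBound.exists_abs_sub_le hκ one_pos
  -- The rate 1/2 is dictated by the area density u/φ²: φ^{-2} then contributes exp |`logRatio`| ≤
  -- 4/(r(2 - r)), exactly compensated by u ≤ r(2 - r). For the volume any rate would do.
  obtain ⟨K', hK'⟩ := OscillationBound.exists_abs_sub_le hκ (half_pos one_pos)
  have hpi := Real.pi_pos
  -- On 1/2 < r < 3/2 one has r(2 - r) ≥ 3/4, hence u ≥ 3κ/4 and exp |`logRatio`| ≤ 16/3; the ratio
  -- of 3/4 to 16/3 is 9/64.
  set D : ℝ := 4 * Real.pi ^ 2 * (9 / 64 * κ * Real.exp (-K)) with hD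
  have hDp : 0 < D := by positivity
  refine ⟨max (Real.log (V₀ / D)) (K' - Real.log (A₀ / (16 * Real.pi)) / 2), ?_⟩
  intro u φ hw hg hu hvol hA
  have hO := hw.oscillationBound hg hκ hu
  set a := logPolar φ 1 0 with ha
  have hlow : -a ≤ Real.log (V₀ / D) := by
    have h1 := (le_vol_warpedMetric hw (m := 9 / 64 * κ * Real.exp (-K) * Real.exp (-a))
      fun r hr θ => ?_).trans hvol
    · have h2 := (ENNReal.ofReal_le_ofReal_iff' ).1 h1
      have h3 : D * Real.exp (-a) ≤ V₀ := by
        have hp : 0 < D * Real.exp (-a) := by positivity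
        rcases h2 with h2 | h2
        · rw [hD]; linarith
        · rw [hD] at hp; linarith
      rw [Real.le_log_iff_exp_le (div_pos (by
        have : 0 < D * Real.exp (-a) := by positivity
        linarith) hDp), le_div_iff₀ hDp]
      linarith
    · have hr2 : r ∈ Ioo (0 : ℝ) 2 := ⟨by linarith [hr.1], by linarith [hr.2]⟩
      have h1 := (abs_le.1 (hK _ hO r hr2 θ)).2
      have h2 := exp_abs_logRatio_le hr2
      have hrr : 3 / 4 ≤ r * (2 - r) := by nlinarith [hr.1, hr.2]
      have h3 : 4 / (r * (2 - r)) ≤ 16 / 3 := by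
        rw [div_le_div_iff₀ (by linarith) (by norm_num)]
        linarith
      have h4 : φ (polarPt r θ) ≤ Real.exp a * Real.exp K * (16 / 3) := by
        rw [← exp_logPolar hw.φ_pos]
        calc Real.exp (logPolar φ r θ) ≤ Real.exp (a + K + |logRatio r|) :=
              Real.exp_le_exp.2 (by linarith)
          _ = Real.exp a * Real.exp K * Real.exp |logRatio r| := by rw [Real.exp_add, Real.exp_add]
          _ ≤ _ := by gcongr; exact h2.trans h3
      have h5 := hu r (Ioo_subset_Icc_self hr2)
      rw [le_div_iff₀ (hw.φ_pos _)]
      calc 9 / 64 * κ * Real.exp (-K) * Real.exp (-a) * φ (polarPt r θ)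
          ≤ 9 / 64 * κ * Real.exp (-K) * Real.exp (-a) *
            (Real.exp a * Real.exp K * (16 / 3)) := by gcongr
        _ = κ * (3 / 4) := by
            rw [Real.exp_neg, Real.exp_neg]
            field_simp
            norm_num
        _ ≤ u r := le_trans (by gcongr) h5
  have hup : a ≤ K' - Real.log (A₀ / (16 * Real.pi)) / 2 := by
    have h1 := area_zeroSphere_le hw (K := 4 * Real.exp (2 * K' - 2 * a)) (by positivity)
      fun r hr θ => ?_
    · have h2 := hA.trans ((iInf₂_le _ (isClosedMinimalSurface_zeroSphere hw)).trans h1)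
      rw [ENNReal.ofReal_le_ofReal_iff (by positivity)] at h2
      have h3 : A₀ / (16 * Real.pi) ≤ Real.exp (2 * K' - 2 * a) := by
        rw [div_le_iff₀ (by positivity)]
        linarith
      have h4 := (Real.log_le_iff_le_exp (by positivity)).2 h3
      linarith
    · have h1 := (abs_le.1 (hK' _ hO r hr θ)).1
      have h2 := exp_abs_logRatio_le hr
      have hrr : 0 < r * (2 - r) := mul_pos hr.1 (by linarith [hr.2])
      have h3 := hw.u_le_mul hg (Ioo_subset_Icc_self hr)
      have h4 : (φ (polarPt r θ) ^ 2)⁻¹ ≤ Real.exp (2 * K' - 2 * a) * (4 / (r * (2 - r))) := by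
        rw [← exp_logPolar hw.φ_pos, ← Real.exp_nat_mul, ← Real.exp_neg]
        calc Real.exp (-((2 : ℕ) * logPolar φ r θ))
            ≤ Real.exp (2 * K' - 2 * a + |logRatio r|) :=
              Real.exp_le_exp.2 (by push_cast; linarith)
          _ = Real.exp (2 * K' - 2 * a) * Real.exp |logRatio r| := Real.exp_add _ _
          _ ≤ _ := by gcongr
      calc u r / φ (polarPt r θ) ^ 2 = u r * (φ (polarPt r θ) ^ 2)⁻¹ := div_eq_mul_inv _ _
        _ ≤ r * (2 - r) * (Real.exp (2 * K' - 2 * a) * (4 / (r * (2 - r)))) :=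
            mul_le_mul h3 h4 (by positivity) hrr.le
        _ = 4 * Real.exp (2 * K' - 2 * a) := by
            have := hrr.ne'
            generalize r * (2 - r) = y at *
            field_simp
  exact abs_le'.2 ⟨hup.trans (le_max_right _ _), hlow.trans (le_max_left _ _)⟩

end Estimates

/-! ### Sequential compactness -/

section Compactness

variable {X : Type*} [TopologicalSpace X] {S : Set X}

/-- Continuous convergence on `S`: `F i y → f x` as `i → ∞` and `y → x` within `S`. -/
def TendstoContinuouslyOn (F : ℕ → X → ℝ) (f : X → ℝ) (S : Set X) : Prop :=
  ∀ x ∈ S, Tendsto (fun q : ℕ × X => F q.1 q.2) (atTop ×ˢ 𝓝[S] x) (𝓝 (f x))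

lemma TendstoContinuouslyOn.tendsto {F : ℕ → X → ℝ} {f : X → ℝ}
    (h : TendstoContinuouslyOn F f S) {x : X} (hx : x ∈ S) :
    Tendsto (fun i => F i x) atTop (𝓝 (f x)) :=
  (h x hx).comp (tendsto_id.prodMk ((tendsto_const_nhdsWithin hx)))

/-- The functions F i need not be continuous: for y near x, the values F i y eventually lie near f
x, and their limit f y does too. -/
lemma TendstoContinuouslyOn.continuousOn {F : ℕ → X → ℝ} {f : X → ℝ}
    (h : TendstoContinuouslyOn F f S) : ContinuousOn f S := by
  intro x hx
  rw [ContinuousWithinAt, Metric.tendsto_nhds]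
  intro ε hε
  have h1 := (Metric.tendsto_nhds.1 (h x hx)) (ε / 2) (half_pos hε)
  obtain ⟨p, hp, q, hq, hpq⟩ := eventually_prod_iff.1 h1
  filter_upwards [hq, self_mem_nhdsWithin] with y hy hyS
  have h2 : dist (f y) (f x) ≤ ε / 2 := by
    refine le_of_tendsto ((h.tendsto hyS).dist tendsto_const_nhds) ?_
    filter_upwards [hp] with i hi using (hpq hi hy).le
  linarith

lemma TendstoContinuouslyOn.tendstoUniformlyOn {F : ℕ → X → ℝ} {f : X → ℝ} {K : Set X}
    (h : TendstoContinuouslyOn F f S) (hK : IsCompact K) (hKS : K ⊆ S) :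
    TendstoUniformlyOn F f atTop K := by
  rw [← tendstoLocallyUniformlyOn_iff_tendstoUniformlyOn_of_compact hK,
    tendstoLocallyUniformlyOn_iff_forall_tendsto]
  intro x hx
  have h1 : Tendsto (fun q : ℕ × X => F q.1 q.2) (atTop ×ˢ 𝓝[K] x) (𝓝 (f x)) :=
    (h x (hKS hx)).mono_left (prod_mono_right _ (nhdsWithin_mono x hKS))
  have h2 : Tendsto (fun q : ℕ × X => f q.2) (atTop ×ˢ 𝓝[K] x) (𝓝 (f x)) :=
    ((h.continuousOn x (hKS hx)).mono hKS).tendsto.comp tendsto_snd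
  have h3 := h2.prodMk_nhds h1
  exact h3.mono_right (nhds_prod_eq.trans_le (nhds_prod_eq.symm.trans_le (nhds_le_uniformity _)))

/-- The Arzelà–Ascoli theorem, in sequential form. -/
theorem exists_subseq_tendstoContinuouslyOn {X : Type*} [PseudoMetricSpace X]
    [SecondCountableTopology X] {S : Set X} {F : ℕ → X → ℝ}
    (hE : ∀ x ∈ S, ∀ ε > 0, ∀ᶠ y in 𝓝[S] x, ∀ i, |F i y - F i x| < ε)
    (hb : ∀ x ∈ S, ∃ C, ∀ i, |F i x| ≤ C) :
    ∃ σ : ℕ → ℕ, StrictMono σ ∧ ∃ f : X → ℝ, TendstoContinuouslyOn (fun i => F (σ i)) f S := by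
  obtain ⟨c, hcS, hc, hdense⟩ :=
    (TopologicalSpace.IsSeparable.of_separableSpace S).exists_countable_dense_subset
  have := hc.to_subtype
  choose C hC using hb
  -- A product of intervals over a countable index set is sequentially compact; this replaces the
  -- diagonal argument on the dense set.
  have hcomp : IsCompact (pi univ fun x : c => Icc (-C x (hcS x.2)) (C x (hcS x.2))) :=
    isCompact_univ_pi fun _ => isCompact_Icc
  obtain ⟨l, -, σ, hσ, hl⟩ := hcomp.tendsto_subseq (x := fun i (x : c) => F i x)
    fun i x _ => abs_le.1 (hC x (hcS x.2) i)
  have hl' := tendsto_pi_nhds.1 hl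
  have hlim : ∀ x ∈ S, ∃ a, Tendsto (fun i => F (σ i) x) atTop (𝓝 a) := fun x hx => by
    apply cauchySeq_tendsto_of_complete
    rw [Metric.cauchySeq_iff']
    intro ε hε
    have h1 := hE x hx (ε / 3) (by positivity)
    have h2 : ∃ᶠ y in 𝓝[S] x, y ∈ c := by
      have := mem_closure_iff_frequently.1 (hdense hx)
      rw [nhdsWithin, frequently_inf_principal]
      exact this.mono fun y hy => ⟨hcS hy, hy⟩
    obtain ⟨y, hyc, hy⟩ := (h2.and_eventually h1).exists
    obtain ⟨N, hN⟩ := Metric.cauchySeq_iff'.1 (hl' ⟨y, hyc⟩).cauchySeq (ε / 3) (by positivity)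
    refine ⟨N, fun n hn => ?_⟩
    have e1 := abs_lt.1 (hy (σ n))
    have e2 := abs_lt.1 (hy (σ N))
    have e3 := hN n hn
    simp only [Function.comp_apply, Real.dist_eq] at e3
    rw [Real.dist_eq, abs_lt]
    have e4 := abs_lt.1 e3
    constructor <;> linarith [e1.1, e1.2, e2.1, e2.2, e4.1, e4.2]
  choose! f hf using hlim
  refine ⟨σ, hσ, f, fun x hx => ?_⟩
  rw [Metric.tendsto_nhds]
  intro ε hε
  have h1 := (Metric.tendsto_nhds.1 (hf x hx) (ε / 2) (half_pos hε)).prod_mk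
    (hE x hx (ε / 2) (half_pos hε))
  filter_upwards [h1] with q hq
  have e1 := hq.1
  have e2 := hq.2 (σ q.1)
  rw [Real.dist_eq] at e1 ⊢
  calc |F (σ q.1) q.2 - f x| ≤ |F (σ q.1) q.2 - F (σ q.1) x| + |F (σ q.1) x - f x| :=
        abs_sub_le _ _ _
    _ < ε := by linarith

end Compactness

/-- Functions with a common oscillation bound are equicontinuous away from the poles. -/
lemma OscillationBound.eventually_abs_sub_lt {κ : ℝ} (hκ : 0 < κ) {x : Coord} (hx : x ∈ strip)
    {ε : ℝ} (hε : 0 < ε) :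
    ∀ᶠ y in 𝓝 x, ∀ F, OscillationBound κ F → |F (y 0) (y 1) - F (x 0) (x 1)| < ε := by
  -- The radial step costs less than 2t and the angular step less than 2(t + t) + t, in all 7t < ε.
  set t := ε / 8 with ht
  have htp : 0 < t := by positivity
  have hL : ContinuousAt logRatio (x 0) := (hasDerivAt_logRatio hx).continuousAt
  have hη : 0 < t * (4 * t * κ) := by positivity
  have h1 : ∀ᶠ s in 𝓝 (x 0), |logRatio s - logRatio (x 0)| < t * (4 * t * κ) := by
    simpa [Real.dist_eq] using Metric.tendsto_nhds.1 hL _ hη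
  have h2 : ∀ᶠ δ in 𝓝[>] (0 : ℝ), |logRatio (x 0 + δ) - logRatio (x 0)| < t * (4 * t * κ) ∧
      x 0 + δ < 2 := by
    have hadd : Tendsto (fun δ => x 0 + δ) (𝓝[>] 0) (𝓝 (x 0)) := by
      have : Tendsto (fun δ => x 0 + δ) (𝓝 0) (𝓝 (x 0 + 0)) := tendsto_const_nhds.add tendsto_id
      rw [add_zero] at this
      exact this.mono_left nhdsWithin_le_nhds
    exact hadd.eventually (h1.and (eventually_lt_nhds hx.2))
  obtain ⟨δ, ⟨hδ1, hδ2⟩, hδ0⟩ := (h2.and self_mem_nhdsWithin).exists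
  have hδ0' : 0 < δ := hδ0
  have hθ : 0 < t / (1 + 2 / δ) := by positivity
  have h3 : ∀ᶠ y : Coord in 𝓝 x, |y 1 - x 1| < t / (1 + 2 / δ) := by
    have hc : ContinuousAt (fun y : Coord => y 1) x := (continuous_apply 1).continuousAt
    simpa [Real.dist_eq] using Metric.tendsto_nhds.1 hc _ hθ
  have h4 : ∀ᶠ y : Coord in 𝓝 x, |logRatio (y 0) - logRatio (x 0)| < t * (4 * t * κ) :=
    (continuous_apply (0 : Fin 3)).continuousAt.tendsto.eventually h1
  filter_upwards [h3, h4, isOpen_strip.mem_nhds hx] with y hy1 hy0 hy F hF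
  have e1 := hF.radial (y 1) (y 0) hy (x 0) hx t htp
  have e2 := hF.angular (x 0) hx δ hδ0' hδ2 t htp (y 1) (x 1)
  have e3 : |logRatio (y 0) - logRatio (x 0)| / (4 * t * κ) < t := by
    rwa [div_lt_iff₀ (by positivity)]
  have e4 : |logRatio (x 0 + δ) - logRatio (x 0)| / (4 * t * κ) < t := by
    rwa [div_lt_iff₀ (by positivity)]
  have e5 : (1 + 2 / δ) * |y 1 - x 1| < t := by
    rwa [lt_div_iff₀ (by positivity), mul_comm] at hy1
  calc |F (y 0) (y 1) - F (x 0) (x 1)|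
      ≤ |F (y 0) (y 1) - F (x 0) (y 1)| + |F (x 0) (y 1) - F (x 0) (x 1)| := abs_sub_le _ _ _
    _ < ε := by linarith

/-! ### Integrability with respect to the standard metric -/

lemma inv_stdMetric {x : Coord} (hx : x ∈ strip) : (stdMetric x)⁻¹ =
    Matrix.diagonal ![((Real.pi / 2) ^ 2)⁻¹, (Real.sin (Real.pi * x 0 / 2) ^ 2)⁻¹, 1] := by
  have h1 := (sin_radius_pos hx).ne'
  have h2 := Real.pi_pos.ne'
  rw [stdMetric, inv_diagonal_three (by positivity) (by positivity) one_ne_zero, inv_one]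

lemma sqrt_det_stdMetric {x : Coord} (hx : x ∈ strip) :
    √ (stdMetric x).det = Real.pi / 2 * Real.sin (Real.pi * x 0 / 2) := by
  have h1 := sin_radius_pos hx
  have h2 := Real.pi_pos
  rw [stdMetric, Matrix.det_diagonal, Real.sqrt_eq_iff_mul_self_eq _ (by positivity)]
  · simp [Fin.prod_univ_three]
    ring
  · simp [Fin.prod_univ_three]
    positivity

lemma box_subset_strip : box ⊆ strip := fun _ hx => hx.1

lemma volMeasure_absolutelyContinuous (G : CoordTensor) :
    volMeasure G ≪ volume.restrict box :=
  withDensity_absolutelyContinuous _ _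

lemma ae_mem_strip (G : CoordTensor) : ∀ᵐ x ∂volMeasure G, x ∈ strip :=
  (volMeasure_absolutelyContinuous G).ae_le
    ((ae_restrict_mem measurableSet_box).mono fun _ hx => box_subset_strip hx)

lemma aestronglyMeasurable_of_continuousOn {g : Coord → ℝ} (hg : ContinuousOn g strip)
    (G : CoordTensor) : AEStronglyMeasurable g (volMeasure G) :=
  ((hg.mono box_subset_strip).aestronglyMeasurable measurableSet_box).mono_ac
    (volMeasure_absolutelyContinuous G)

lemma sin_radius_le {r : ℝ} (hr : r ∈ Ioo (0 : ℝ) 2) :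
    Real.sin (Real.pi * r / 2) ≤ Real.pi / 2 * (r * (2 - r)) := by
  have hpi := Real.pi_pos
  have h1 := Real.sin_le (by have := hr.1; positivity : 0 ≤ Real.pi * r / 2)
  have h2 := Real.sin_le (by nlinarith [hr.2] : 0 ≤ Real.pi - Real.pi * r / 2)
  rw [Real.sin_pi_sub] at h2
  rcases le_total r 1 with h | h
  · have : r ≤ r * (2 - r) := by nlinarith [hr.1]
    nlinarith
  · have : 2 - r ≤ r * (2 - r) := by nlinarith [hr.2]
    nlinarith

/-- Jordan's inequality, applied from the nearer pole. It makes the θθ-coefficient of the warped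
metrics comparable to sin²(πr/2), the one of g₀, at the poles. -/
lemma le_sin_radius {r v : ℝ} (hr : r ∈ Ioo (0 : ℝ) 2) (h1 : v ≤ r) (h2 : v ≤ 2 - r) :
    v ≤ Real.sin (Real.pi * r / 2) := by
  have hpi := Real.pi_pos
  rcases le_total r 1 with h | h
  · have h3 := Real.mul_le_sin (x := Real.pi * r / 2) (by have := hr.1; positivity) (by nlinarith)
    have h4 : 2 / Real.pi * (Real.pi * r / 2) = r := by field_simp
    linarith
  · have h3 := Real.mul_le_sin (x := Real.pi - Real.pi * r / 2) (by nlinarith [hr.2])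
      (by nlinarith)
    have h4 : 2 / Real.pi * (Real.pi - Real.pi * r / 2) = 2 - r := by field_simp
    rw [Real.sin_pi_sub] at h3
    linarith

/-- The volume density of g₀ vanishes to first order at the poles, like r(2 - r), and cancels the
singularity. -/
lemma lintegral_inv_radius_lt_top {C : ℝ} (hC : 0 ≤ C) :
    ∫⁻ x, ENNReal.ofReal (C / (x 0 * (2 - x 0))) ∂volMeasure stdMetric < ⊤ := by
  have hpi := Real.pi_pos
  have hm : Measurable fun x : Coord => ENNReal.ofReal (√ (stdMetric x).det) := by
    have : Continuous fun x : Coord => √ (stdMetric x).det := by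
      simp only [stdMetric, Matrix.det_diagonal, Fin.prod_univ_three]
      simp
      fun_prop
    exact this.measurable.ennreal_ofReal
  calc ∫⁻ x, ENNReal.ofReal (C / (x 0 * (2 - x 0))) ∂volMeasure stdMetric
      ≤ ∫⁻ x in box, ((fun x => ENNReal.ofReal (√ (stdMetric x).det)) *
          fun x : Coord => ENNReal.ofReal (C / (x 0 * (2 - x 0)))) x := by
        rw [volMeasure]
        -- The inequality suffices, and it requires measurability of the density only.
        exact lintegral_withDensity_le_lintegral_mul _ hm _
    _ ≤ ∫⁻ x in box, ENNReal.ofReal ((Real.pi / 2) ^ 2 * C) := by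
        refine setLIntegral_mono' measurableSet_box fun x hx => ?_
        have hx' := box_subset_strip hx
        have h1 := sin_radius_le hx'
        have h2 := sin_radius_pos hx'
        have h3 : 0 < x 0 * (2 - x 0) := mul_pos hx'.1 (by linarith [hx'.2])
        rw [Pi.mul_apply, sqrt_det_stdMetric hx', ← ENNReal.ofReal_mul (by positivity)]
        refine ENNReal.ofReal_le_ofReal ?_
        rw [mul_div_assoc', div_le_iff₀ h3]
        calc Real.pi / 2 * Real.sin (Real.pi * x 0 / 2) * C
            ≤ Real.pi / 2 * (Real.pi / 2 * (x 0 * (2 - x 0))) * C := by gcongr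
          _ = _ := by ring
    _ ≤ ∫⁻ x in Icc (fun _ => 0) (![2, 2 * Real.pi, 2 * Real.pi] : Coord),
          ENNReal.ofReal ((Real.pi / 2) ^ 2 * C) := by
        refine lintegral_mono_set fun x hx => ?_
        constructor <;> intro i <;> fin_cases i
        exacts [hx.1.1.le, hx.2.1.1.le, hx.2.2.1.le, hx.1.2.le, hx.2.1.2.le, hx.2.2.2.le]
    _ < ⊤ := by
        rw [setLIntegral_const]
        exact ENNReal.mul_lt_top ENNReal.ofReal_lt_top isCompact_Icc.measure_lt_top

lemma continuousOn_inv_stdMetric : ContinuousOn (fun x => (stdMetric x)⁻¹) strip := by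
  have h : ContinuousOn (fun x : Coord => (Matrix.diagonal ![((Real.pi / 2) ^ 2)⁻¹,
      (Real.sin (Real.pi * x 0 / 2) ^ 2)⁻¹, 1] : Matrix (Fin 3) (Fin 3) ℝ)) strip := by
    refine continuousOn_pi.2 fun a => continuousOn_pi.2 fun b => ?_
    have hs : ContinuousOn (fun x : Coord => (Real.sin (Real.pi * x 0 / 2) ^ 2)⁻¹) strip :=
      ContinuousOn.inv₀ (by fun_prop) fun x hx => (pow_pos (sin_radius_pos hx) 2).ne'
    fin_cases a <;> fin_cases b <;> simp [continuousOn_const, hs]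
  exact h.congr fun x hx => inv_stdMetric hx

lemma continuousOn_tensorNorm {T : CoordTensor}
    (hT : ∀ a b, ContinuousOn (fun x => T x a b) strip) : ContinuousOn (tensorNorm T) strip := by
  have h1 : ContinuousOn T strip := continuousOn_pi.2 fun a => continuousOn_pi.2 fun b => hT a b
  have h2 := continuousOn_inv_stdMetric
  have h3 : ContinuousOn (fun x => ((stdMetric x)⁻¹ * T x * (stdMetric x)⁻¹ * T x)) strip :=
    ((h2.mul h1).mul h2).mul h1
  have h4 : Continuous fun A : Matrix (Fin 3) (Fin 3) ℝ => √ A.trace :=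
    Real.continuous_sqrt.comp (Continuous.matrix_trace continuous_id)
  exact h4.comp_continuousOn h3

lemma tensorNorm_diagonal_le {T : CoordTensor} {x : Coord} (hx : x ∈ strip) {a b c m : ℝ}
    (hT : T x = Matrix.diagonal ![a, b, c]) (hm : 0 ≤ m) (ha : |a| ≤ m)
    (hb : |b| ≤ m * Real.sin (Real.pi * x 0 / 2) ^ 2) (hc : |c| ≤ m) :
    tensorNorm T x ≤ 3 * m := by
  have hs := sin_radius_pos hx
  have hpi := Real.pi_gt_three
  rw [tensorNorm, Real.sqrt_le_left (by positivity), inv_stdMetric hx, hT]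
  simp only [Matrix.diagonal_mul_diagonal, Matrix.trace_diagonal, Fin.sum_univ_three]
  simp
  have h1 : |(Real.pi / 2)⁻¹ ^ 2 * a| ≤ m := by
    rw [abs_mul, abs_of_nonneg (by positivity)]
    have : (Real.pi / 2)⁻¹ ^ 2 ≤ 1 := pow_le_one₀ (by positivity) (inv_le_one_of_one_le₀ (by linarith))
    nlinarith [abs_nonneg a]
  have h2 : |(Real.sin (Real.pi * x 0 / 2) ^ 2)⁻¹ * b| ≤ m := by
    rw [abs_mul, abs_of_nonneg (by positivity), inv_mul_le_iff₀ (by positivity)]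
    linarith
  have e1 := sq_le_sq' (abs_le.1 h1).1 (abs_le.1 h1).2
  have e2 := sq_le_sq' (abs_le.1 h2).1 (abs_le.1 h2).2
  have e3 := sq_le_sq' (abs_le.1 hc).1 (abs_le.1 hc).2
  have e4 : ((Real.pi / 2) ^ 2)⁻¹ = (Real.pi / 2)⁻¹ ^ 2 := by rw [inv_pow]
  have e5 : 2 ^ 2 / Real.pi ^ 2 = (Real.pi / 2)⁻¹ ^ 2 := by field_simp
  simp only [div_pow, inv_div] at *
  nlinarith

/-! ### Convergence in `Lᵖ` -/

/-- The bounds on a warped product metric that dominate its `Lᵖ` norm. -/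
structure DominatedPair (C η : ℝ) (v : ℝ → ℝ) (φ : S2 → ℝ) : Prop where
  cont : ∀ a b, ContinuousOn (fun x => warpedMetric v φ x a b) strip
  pos : ∀ r ∈ Ioo (0 : ℝ) 2, ∀ θ, 0 < φ (polarPt r θ)
  log_le : ∀ r ∈ Ioo (0 : ℝ) 2, ∀ θ, |logPolar φ r θ| ≤ C + η * |logRatio r|
  nonneg : ∀ r ∈ Ioo (0 : ℝ) 2, 0 ≤ v r
  le_sin : ∀ r ∈ Ioo (0 : ℝ) 2, v r ≤ Real.sin (Real.pi * r / 2)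

section Domination

variable {C η : ℝ} {v w : ℝ → ℝ} {φ ψ : S2 → ℝ}

lemma DominatedPair.coeff_le (h : DominatedPair C η v φ) {x : Coord} (hx : x ∈ strip) :
    (φ (polarPt (x 0) (x 1)) ^ 2)⁻¹ ≤ Real.exp (2 * (C + η * |logRatio (x 0)|)) ∧
    (φ (polarPt (x 0) (x 1)) ^ 2)⁻¹ * v (x 0) ^ 2 ≤
      Real.exp (2 * (C + η * |logRatio (x 0)|)) * Real.sin (Real.pi * x 0 / 2) ^ 2 ∧
    φ (polarPt (x 0) (x 1)) ^ 2 ≤ Real.exp (2 * (C + η * |logRatio (x 0)|)) := by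
  have hp := h.pos _ hx (x 1)
  have hl := abs_le.1 (h.log_le _ hx (x 1))
  have he : φ (polarPt (x 0) (x 1)) ^ 2 = Real.exp (2 * logPolar φ (x 0) (x 1)) := by
    rw [← Real.exp_log hp, ← Real.exp_nat_mul]
    simp [logPolar]
  have h1 : (φ (polarPt (x 0) (x 1)) ^ 2)⁻¹ ≤ Real.exp (2 * (C + η * |logRatio (x 0)|)) := by
    rw [he, ← Real.exp_neg]
    exact Real.exp_le_exp.2 (by linarith [hl.1])
  refine ⟨h1, ?_, ?_⟩
  · exact mul_le_mul h1 (pow_le_pow_left₀ (h.nonneg _ hx) (h.le_sin _ hx) 2) (sq_nonneg _)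
      (Real.exp_pos _).le
  · rw [he]
    exact Real.exp_le_exp.2 (by linarith [hl.2])

lemma DominatedPair.tensorNorm_le (h : DominatedPair C η v φ) {x : Coord} (hx : x ∈ strip) :
    tensorNorm (warpedMetric v φ) x ≤ 3 * Real.exp (2 * (C + η * |logRatio (x 0)|)) := by
  obtain ⟨h0, h1, h2⟩ := h.coeff_le hx
  refine tensorNorm_diagonal_le hx rfl (Real.exp_pos _).le ?_ ?_ ?_ <;>
    rwa [abs_of_nonneg (by positivity)]

/-- Corresponding diagonal coefficients are nonnegative, so their difference is at most the larger
one and no factor 2 is lost. -/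
lemma DominatedPair.tensorNorm_sub_le (h : DominatedPair C η v φ) (h' : DominatedPair C η w ψ)
    {x : Coord} (hx : x ∈ strip) : tensorNorm (warpedMetric v φ - warpedMetric w ψ) x
      ≤ 3 * Real.exp (2 * (C + η * |logRatio (x 0)|)) := by
  have key : ∀ a b m : ℝ, 0 ≤ a → 0 ≤ b → a ≤ m → b ≤ m → |a - b| ≤ m :=
    fun a b m ha hb ham hbm => abs_le.2 ⟨by linarith, by linarith⟩
  obtain ⟨h0, h1, h2⟩ := h.coeff_le hx
  obtain ⟨h0', h1', h2'⟩ := h'.coeff_le hx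
  refine tensorNorm_diagonal_le hx ?_ (Real.exp_pos _).le
    (key _ _ _ (by positivity) (by positivity) h0 h0')
    (key _ _ _ (by positivity) (by positivity) h1 h1')
    (key _ _ _ (by positivity) (by positivity) h2 h2')
  rw [Pi.sub_apply, warpedMetric, warpedMetric, Matrix.diagonal_sub]
  congr 1
  ext i
  fin_cases i <;> rfl

/-- An integrable majorant for the `p`-th power of the norm of a dominated tensor. -/
lemma enorm_rpow_le {p : ℝ} (hp : 0 < p) {g : ℝ} {x : Coord} (hx : x ∈ strip) (hg : 0 ≤ g)
    (h : g ≤ 3 * Real.exp (2 * (C + 1 / (2 * p) * |logRatio (x 0)|))) :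
    ‖g‖ₑ ^ p ≤ ENNReal.ofReal (3 ^ p * Real.exp (2 * p * C) * 4 / (x 0 * (2 - x 0))) := by
  rw [Real.enorm_eq_ofReal hg, ENNReal.ofReal_rpow_of_nonneg hg hp.le]
  refine ENNReal.ofReal_le_ofReal ?_
  have h1 := exp_abs_logRatio_le hx
  calc g ^ p ≤ (3 * Real.exp (2 * (C + 1 / (2 * p) * |logRatio (x 0)|))) ^ p :=
        Real.rpow_le_rpow hg h hp.le
    -- With the rate 1/(2p), the p-th power of exp(2 · rate · |`logRatio`|) is exactly exp
    -- |`logRatio`|, so one singularity serves for all p.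
    _ = 3 ^ p * (Real.exp (2 * p * C) * Real.exp |logRatio (x 0)|) := by
        rw [Real.mul_rpow (by norm_num) (Real.exp_pos _).le, ← Real.exp_mul, ← Real.exp_add]
        congr 2
        field_simp
    _ ≤ 3 ^ p * (Real.exp (2 * p * C) * (4 / (x 0 * (2 - x 0)))) := by gcongr
    _ = _ := by ring

lemma tensorNorm_nonneg (T : CoordTensor) (x : Coord) : 0 ≤ tensorNorm T x := Real.sqrt_nonneg _

lemma DominatedPair.memTensorLp {p : ℝ≥0∞} (hp1 : 1 ≤ p) (hp : p < ⊤)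
    (h : DominatedPair C (1 / (2 * p.toReal)) v φ) : MemTensorLp (warpedMetric v φ) p := by
  have hp0 : 0 < p.toReal := ENNReal.toReal_pos (zero_lt_one.trans_le hp1).ne' hp.ne
  refine ⟨fun a b => aestronglyMeasurable_of_continuousOn (h.cont a b) _,
    aestronglyMeasurable_of_continuousOn (continuousOn_tensorNorm h.cont) _, ?_⟩
  rw [eLpNorm_lt_top_iff_lintegral_rpow_enorm_lt_top (zero_lt_one.trans_le hp1).ne' hp.ne]
  refine lt_of_le_of_lt (lintegral_mono_ae ?_) (lintegral_inv_radius_lt_top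
    (C := 3 ^ p.toReal * Real.exp (2 * p.toReal * C) * 4) (by positivity))
  filter_upwards [ae_mem_strip stdMetric] with x hx
  exact enorm_rpow_le hp0 hx (tensorNorm_nonneg _ _) (h.tensorNorm_le hx)

lemma tendsto_tensorNorm_sub {T : ℕ → CoordTensor} {T' : CoordTensor} {x : Coord}
    (h : ∀ a b, Tendsto (fun i => T i x a b) atTop (𝓝 (T' x a b))) :
    Tendsto (fun i => tensorNorm (T i - T') x) atTop (𝓝 0) := by
  have h1 : Tendsto (fun i => T i x - T' x) atTop (𝓝 (0 : Matrix (Fin 3) (Fin 3) ℝ)) := by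
    refine tendsto_pi_nhds.2 fun a => tendsto_pi_nhds.2 fun b => ?_
    simpa using (h a b).sub_const (T' x a b)
  have h2 : Continuous fun A : Matrix (Fin 3) (Fin 3) ℝ =>
      √ ((stdMetric x)⁻¹ * A * (stdMetric x)⁻¹ * A).trace :=
    Real.continuous_sqrt.comp (Continuous.matrix_trace
      (((continuous_const.mul continuous_id).mul continuous_const).mul continuous_id))
  have h3 := (h2.tendsto 0).comp h1
  simp only [mul_zero, Matrix.trace_zero, Real.sqrt_zero] at h3
  exact h3

theorem tendstoTensorLp_of_dominated {p : ℝ≥0∞} (hp1 : 1 ≤ p) (hp : p < ⊤) {v : ℕ → ℝ → ℝ}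
    {φ : ℕ → S2 → ℝ} (h : ∀ i, DominatedPair C (1 / (2 * p.toReal)) (v i) (φ i))
    (h' : DominatedPair C (1 / (2 * p.toReal)) w ψ)
    (hlim : ∀ x ∈ strip, ∀ a b, Tendsto (fun i => warpedMetric (v i) (φ i) x a b) atTop
      (𝓝 (warpedMetric w ψ x a b))) :
    TendstoTensorLp (fun i => warpedMetric (v i) (φ i)) (warpedMetric w ψ) p := by
  have hp0 : 0 < p.toReal := ENNReal.toReal_pos (zero_lt_one.trans_le hp1).ne' hp.ne
  refine ⟨fun i => (h i).memTensorLp hp1 hp, h'.memTensorLp hp1 hp, ?_⟩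
  have hI : Tendsto (fun i => ∫⁻ x, ‖tensorNorm (warpedMetric (v i) (φ i) - warpedMetric w ψ) x‖ₑ
      ^ p.toReal ∂volMeasure stdMetric) atTop (𝓝 (∫⁻ _, 0 ∂volMeasure stdMetric)) := by
    refine tendsto_lintegral_of_dominated_convergence'
      (fun x => ENNReal.ofReal (3 ^ p.toReal * Real.exp (2 * p.toReal * C) * 4 /
        (x 0 * (2 - x 0)))) ?_ ?_ (lintegral_inv_radius_lt_top (by positivity)).ne ?_
    · intro i
      exact ((aestronglyMeasurable_of_continuousOn (continuousOn_tensorNorm fun a b =>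
        ((h i).cont a b).sub (h'.cont a b)) _).enorm).pow_const _
    · intro i
      filter_upwards [ae_mem_strip stdMetric] with x hx
      exact enorm_rpow_le hp0 hx (tensorNorm_nonneg _ _) ((h i).tensorNorm_sub_le h' hx)
    · filter_upwards [ae_mem_strip stdMetric] with x hx
      have h1 := (tendsto_tensorNorm_sub (T := fun i => warpedMetric (v i) (φ i)) (hlim x hx)).enorm
      have h2 := (ENNReal.continuous_rpow_const (y := p.toReal)).continuousAt.tendsto.comp h1
      rw [enorm_zero, ENNReal.zero_rpow_of_pos hp0] at h2
      exact h2
  simp only [eLpNorm_eq_lintegral_rpow_enorm_toReal (zero_lt_one.trans_le hp1).ne' hp.ne]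
  have h2 := (ENNReal.continuous_rpow_const (y := 1 / p.toReal)).continuousAt.tendsto.comp hI
  rw [lintegral_zero, ENNReal.zero_rpow_of_pos (by positivity)] at h2
  exact h2

end Domination

/-- The coefficients of warped product metrics converge where the warping data converge. -/
lemma tendstoContinuouslyOn_warpedMetric {v : ℕ → ℝ → ℝ} {φ : ℕ → S2 → ℝ} {w : ℝ → ℝ} {ψ : S2 → ℝ}
    (hv : TendstoContinuouslyOn v w (Icc 0 2))
    (hφ : TendstoContinuouslyOn (fun i x => φ i (polarPt (x 0) (x 1)))
      (fun x => ψ (polarPt (x 0) (x 1))) strip)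
    (hψ : ∀ x ∈ strip, ψ (polarPt (x 0) (x 1)) ≠ 0) (a b : Fin 3) :
    TendstoContinuouslyOn (fun i x => warpedMetric (v i) (φ i) x a b)
      (fun x => warpedMetric w ψ x a b) strip := by
  intro x hx
  have h1 := hφ x hx
  have h2 : Tendsto (fun q : ℕ × Coord => v q.1 (q.2 0)) (atTop ×ˢ 𝓝[strip] x) (𝓝 (w (x 0))) := by
    refine (hv (x 0) (Ioo_subset_Icc_self hx)).comp
      (f := fun q : ℕ × Coord => ((q.1, q.2 0) : ℕ × ℝ)) (tendsto_fst.prodMk ?_)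
    refine Tendsto.comp (f := Prod.snd) (g := fun y : Coord => y 0) ?_ tendsto_snd
    exact (continuous_apply (0 : Fin 3)).continuousWithinAt.tendsto_nhdsWithin
      fun y hy => Ioo_subset_Icc_self hy
  have h3 := (h1.pow 2).inv₀ (pow_ne_zero 2 (hψ x hx))
  fin_cases a <;> fin_cases b
  · exact h3
  · exact tendsto_const_nhds
  · exact tendsto_const_nhds
  · exact tendsto_const_nhds
  · exact h3.mul (h2.pow 2)
  · exact tendsto_const_nhds
  · exact tendsto_const_nhds
  · exact tendsto_const_nhds
  · exact h1.pow 2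

/-- By periodicity, uniform convergence for all θ reduces to a compact box. The third coordinate is
frozen at 0, since the coefficients do not depend on ξ. -/
lemma exists_mem_Icc_polarPt {ε : ℝ} {r : ℝ} (hr : r ∈ Icc ε (2 - ε)) (θ : ℝ) :
    ∃ θ', (![r, θ', 0] : Coord) ∈ Icc (![ε, 0, 0] : Coord) ![2 - ε, 2 * Real.pi, 0] ∧
      polarPt r θ' = polarPt r θ := by
  obtain ⟨θ', hθ, e⟩ := exists_angle_polarPt r θ
  refine ⟨θ', ⟨?_, ?_⟩, e⟩ <;> intro i <;> fin_cases i
  exacts [hr.1, hθ.1, le_rfl, hr.2, hθ.2, le_rfl]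

lemma Icc_subset_strip {ε : ℝ} (hε : 0 < ε) :
    Icc (![ε, 0, 0] : Coord) ![2 - ε, 2 * Real.pi, 0] ⊆ strip := fun x hx => by
  have h0 : ε ≤ x 0 := hx.1 0
  have h1 : x 0 ≤ 2 - ε := hx.2 0
  exact ⟨by linarith, by linarith⟩

end WarpedS2S1

end
-- Extraction of the limit metric and the two modes of convergence
open WarpedS2S1 in
theorem theorem1p3 (V₀ A₀ : ℝ) (hA₀ : 0 < A₀)
    (u : ℕ → ℝ → ℝ) (φ : ℕ → WarpedS2S1.S2 → ℝ)
    (hsmooth : ∀ i, WarpedS2S1.IsWarpingPair (u i) (φ i))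
    (hscal : ∀ i, ∀ x ∈ WarpedS2S1.strip,
      0 ≤ WarpedS2S1.scalarCurvature (WarpedS2S1.warpedMetric (u i) (φ i)) x)
    (hvol : ∀ i, WarpedS2S1.vol (WarpedS2S1.warpedMetric (u i) (φ i)) ≤ ENNReal.ofReal V₀)
    (hminA : ∀ i, ENNReal.ofReal A₀ ≤ WarpedS2S1.minA (WarpedS2S1.warpedMetric (u i) (φ i))) :
    ∃ (σ : ℕ → ℕ) (uInf : ℝ → ℝ) (φInf : WarpedS2S1.S2 → ℝ),
      StrictMono σ ∧
      -- the limits that define `g_∞`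
      TendstoUniformlyOn (fun i => u (σ i)) uInf atTop (Icc 0 2) ∧
      (∀ ε ∈ Ioo (0 : ℝ) 1,
        TendstoUniformlyOn (fun i => φ (σ i)) φInf atTop (WarpedS2S1.OmegaEps ε)) ∧
      (∀ r ∈ Ioo (0 : ℝ) 2, 0 < uInf r) ∧
      (∀ r ∈ Ioo (0 : ℝ) 2, ∀ θ : ℝ, 0 < φInf (WarpedS2S1.polarPt r θ)) ∧
      -- convergence in `Lᵖ(M, g₀)`
      (∀ p : ℝ≥0∞, 1 ≤ p → p < ⊤ →
        WarpedS2S1.TendstoTensorLp (fun i => WarpedS2S1.warpedMetric (u (σ i)) (φ (σ i)))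
          (WarpedS2S1.warpedMetric uInf φInf) p) ∧
      -- uniform convergence of the coefficients on the interior regions
      (∀ ε ∈ Ioo (0 : ℝ) 1, ∀ a b : Fin 3,
        TendstoUniformlyOn
          (fun i x => WarpedS2S1.warpedMetric (u (σ i)) (φ (σ i)) x a b)
          (fun x => WarpedS2S1.warpedMetric uInf φInf x a b) atTop (WarpedS2S1.MEps ε)) := by
  have hg : ∀ i, GradientBound (u i) (φ i) := fun i r hr θ =>
    (hsmooth i).gradient_bound (hscal i) hr θ
  set κ := A₀ / (16 * Real.pi ^ 2) with hκdef
  have hκ : 0 < κ := by have := Real.pi_pos; positivity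
  have hu : ∀ i, ∀ r ∈ Icc (0 : ℝ) 2, κ * (r * (2 - r)) ≤ u i r := fun i r hr =>
    (hsmooth i).lower_bound (hg i) (hminA i) hr
  have hO : ∀ i, OscillationBound κ (logPolar (φ i)) := fun i =>
    (hsmooth i).oscillationBound (hg i) hκ (hu i)
  obtain ⟨C₀, hC₀⟩ := exists_abs_logPolar_one_le hκ hA₀ V₀
  have hC : ∀ i, |logPolar (φ i) 1 0| ≤ C₀ := fun i =>
    hC₀ (u i) (φ i) (hsmooth i) (hg i) (hu i) (hvol i) (hminA i)
  have hbound : ∀ η > 0, ∃ C, ∀ i, ∀ r ∈ Ioo (0 : ℝ) 2, ∀ θ,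
      |logPolar (φ i) r θ| ≤ C + η * |logRatio r| := fun η hη => by
    obtain ⟨K, hK⟩ := OscillationBound.exists_abs_sub_le hκ hη
    refine ⟨C₀ + K, fun i r hr θ => ?_⟩
    have h1 := hK _ (hO i) r hr θ
    have h2 := abs_sub_abs_le_abs_sub (logPolar (φ i) r θ) (logPolar (φ i) 1 0)
    linarith [hC i]
  obtain ⟨σ₁, hσ₁, uInf, huInf⟩ := exists_subseq_tendstoContinuouslyOn (F := u)
    (S := Icc (0 : ℝ) 2) (fun x hx ε hε => by
      filter_upwards [self_mem_nhdsWithin, mem_nhdsWithin_of_mem_nhds (Metric.ball_mem_nhds x hε)]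
        with y hy hyε i
      exact ((hsmooth i).abs_sub_le (hg i) hy hx).trans_lt hyε)
    (fun x hx => ⟨x, fun i => by
      rw [abs_of_nonneg ((hsmooth i).u_nonneg hx)]
      exact ((hsmooth i).u_le (hg i) hx).1⟩)
  obtain ⟨C₁, hC₁⟩ := hbound 1 one_pos
  obtain ⟨σ₂, hσ₂, f, hf⟩ := exists_subseq_tendstoContinuouslyOn
    (F := fun i (x : Coord) => logPolar (φ (σ₁ i)) (x 0) (x 1)) (S := strip)
    (fun x hx ε hε => by
      filter_upwards [mem_nhdsWithin_of_mem_nhds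
        (OscillationBound.eventually_abs_sub_lt hκ hx hε)] with y hy i
      exact hy _ (hO (σ₁ i)))
    (fun x hx => ⟨_, fun i => hC₁ (σ₁ i) (x 0) hx (x 1)⟩)
  set σ := σ₁ ∘ σ₂ with hσ
  have hut : TendstoContinuouslyOn (fun i => u (σ i)) uInf (Icc 0 2) := fun x hx =>
    (huInf x hx).comp ((hσ₂.tendsto_atTop.comp tendsto_fst).prodMk tendsto_snd)
  -- Taking the limit on the sphere itself makes it independent of the choice of θ. At the poles,
  -- where a limit need not exist, the value is immaterial.
  let φInf : S2 → ℝ := fun q => limUnder atTop fun i => φ (σ i) q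
  have hexp : TendstoContinuouslyOn (fun i x => φ (σ i) (polarPt (x 0) (x 1)))
      (fun x => Real.exp (f x)) strip := fun x hx => by
    refine ((Real.continuous_exp.tendsto _).comp (hf x hx)).congr fun q => ?_
    exact exp_logPolar (hsmooth (σ q.1)).φ_pos _ _
  have hφInf : ∀ x ∈ strip, φInf (polarPt (x 0) (x 1)) = Real.exp (f x) := fun x hx =>
    (hexp.tendsto hx).limUnder_eq
  have hφt : TendstoContinuouslyOn (fun i x => φ (σ i) (polarPt (x 0) (x 1)))
      (fun x => φInf (polarPt (x 0) (x 1))) strip := fun x hx => by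
    simp only [hφInf x hx]
    exact hexp x hx
  have hφpos : ∀ r ∈ Ioo (0 : ℝ) 2, ∀ θ : ℝ, 0 < φInf (polarPt r θ) := fun r hr θ => by
    have h := hφInf ![r, θ, 0] hr
    simp only [Matrix.cons_val_zero, Matrix.cons_val_one] at h
    rw [h]
    exact Real.exp_pos _
  have hu0 : ∀ r ∈ Ioo (0 : ℝ) 2, 0 < uInf r := fun r hr => by
    have h1 : κ * (r * (2 - r)) ≤ uInf r :=
      ge_of_tendsto' (hut.tendsto (Ioo_subset_Icc_self hr))
        fun i => hu (σ i) r (Ioo_subset_Icc_self hr)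
    have h2 : 0 < κ * (r * (2 - r)) := mul_pos hκ (mul_pos hr.1 (by linarith [hr.2]))
    linarith
  have husin : ∀ i, ∀ r ∈ Ioo (0 : ℝ) 2, u i r ≤ Real.sin (Real.pi * r / 2) := fun i r hr => by
    obtain ⟨h1, h2⟩ := (hsmooth i).u_le (hg i) (Ioo_subset_Icc_self hr)
    exact le_sin_radius hr h1 h2
  have hcoef : ∀ a b, TendstoContinuouslyOn
      (fun i x => warpedMetric (u (σ i)) (φ (σ i)) x a b)
      (fun x => warpedMetric uInf φInf x a b) strip :=
    tendstoContinuouslyOn_warpedMetric hut hφt fun x hx => (hφpos _ hx _).ne'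
  -- Continuity of each metric is obtained by applying the convergence lemma to constant sequences.
  have hcont : ∀ i a b, ContinuousOn (fun x => warpedMetric (u i) (φ i) x a b) strip :=
    fun i => by
    refine fun a b => (tendstoContinuouslyOn_warpedMetric (v := fun _ => u i) (φ := fun _ => φ i)
      (w := u i) (ψ := φ i) (fun x hx => ?_) (fun x hx => ?_)
      (fun x _ => ((hsmooth i).φ_pos _).ne') a b).continuousOn
    · exact ((hsmooth i).u_smooth.continuousOn x hx).tendsto.comp tendsto_snd
    · exact (((hsmooth i).contDiff_polar (r := fun x : Coord => x 0) (θ := fun x => x 1)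
        (by fun_prop) (by fun_prop)).continuous.continuousWithinAt).tendsto.comp tendsto_snd
  refine ⟨σ, uInf, φInf, hσ₁.comp hσ₂, hut.tendstoUniformlyOn isCompact_Icc subset_rfl, ?_, hu0,
    hφpos, ?_, ?_⟩
  · intro ε hε
    have h := hφt.tendstoUniformlyOn (isCompact_Icc (a := (![ε, 0, 0] : Coord))
      (b := ![2 - ε, 2 * Real.pi, 0])) (Icc_subset_strip hε.1)
    rw [Metric.tendstoUniformlyOn_iff] at h ⊢
    intro δ hδ
    filter_upwards [h δ hδ] with i hi
    rintro q ⟨r, hr, θ, rfl⟩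
    obtain ⟨θ', hmem, e⟩ := exists_mem_Icc_polarPt hr θ
    simpa [e] using hi _ hmem
  · intro p hp1 hp
    have hp0 : 0 < p.toReal := ENNReal.toReal_pos (zero_lt_one.trans_le hp1).ne' hp.ne
    -- The growth rate depends on p, whereas the subsequence and the limit do not.
    obtain ⟨C, hC⟩ := hbound (1 / (2 * p.toReal)) (by positivity)
    refine tendstoTensorLp_of_dominated hp1 hp (C := C) (fun i => ?_) ?_
      fun x hx a b => (hcoef a b).tendsto hx
    · exact ⟨hcont (σ i), fun _ _ _ => (hsmooth _).φ_pos _, hC (σ i),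
        fun r hr => ((hsmooth _).u_pos r hr).le, husin (σ i)⟩
    -- The limit inherits the same bounds, since they are closed under pointwise convergence.
    · refine ⟨fun a b => (hcoef a b).continuousOn, hφpos, fun r hr θ => ?_,
        fun r hr => (hu0 r hr).le, fun r hr => ?_⟩
      · have h1 := hφInf ![r, θ, 0] hr
        simp only [Matrix.cons_val_zero, Matrix.cons_val_one] at h1
        rw [logPolar, h1, Real.log_exp]
        refine le_of_tendsto' (hf.tendsto (x := ![r, θ, 0]) hr).abs fun i => ?_
        exact hC (σ i) r hr θ
      · exact le_of_tendsto' (hut.tendsto (Ioo_subset_Icc_self hr)) fun i => husin (σ i) r hr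
  · intro ε hε a b
    have h := (hcoef a b).tendstoUniformlyOn (isCompact_Icc (a := (![ε, 0, 0] : Coord))
      (b := ![2 - ε, 2 * Real.pi, 0])) (Icc_subset_strip hε.1)
    rw [Metric.tendstoUniformlyOn_iff] at h ⊢
    intro δ hδ
    filter_upwards [h δ hδ] with i hi x hx
    obtain ⟨θ', hmem, e⟩ := exists_mem_Icc_polarPt hx (x 1)
    simpa [warpedMetric, e] using hi _ hmem
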